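/- Let $n\ge 2$. Let $N_n$ be the group of real unipotent upper triangular $n\times n$ matrices and let $N_n^+\subset N_n$ be the set of totally positive matrices, i.e. of those $M\in N_n$ for which every minor that does not vanish identically on $N_n$ is positive. Let $P$ be the permutation matrix $P_{ij}=\delta_{i+j,n+1}$. For every $M\in N_n^+$ there are unique $M',M''\in N_n^+$ and a unique diagonal matrix $D_M$ such that $$PMP=M'\,P\,D_M\,M'';$$ this defines two maps $M\mapsto M'$ and $M\mapsto M''$ of $N_n^+$ to itself. Let $\sigma_1,\sigma_2$ be the generators of the symmetric group $S_3$ with $\sigma_1^2=\sigma_2^2=\mathrm{id}$, $\sigma_1\sigma_2\sigma_1=\sigma_2\sigma_1\sigma_2$. For $M\in N_n^+$ put $$\mathrm{id}(M)=M,\quad \sigma_1(M)=M',\quad \sigma_2(M)=M'',\quad (\sigma_2\sigma_1)(M)=(M')'',\quad (\sigma_1\sigma_2)(M)=(M'')',$$ and for the longest element $s=\sigma_1\sigma_2\sigma_1=\sigma_2\sigma_1\sigma_2$ let $s(M)$ denote either one of the (in general different) matrices $((M')'')'$ and $((M'')')''$; the claim below holds for each choice. Write $[a,b]=\{i\in\mathbb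 N: a\le i\le b\}$. For $I,J\subset[1,n]$ let $\Delta_I(M)$ be the minor of $M$ with rows $I$ and the last $|I|$ columns, let $\Delta^J(M)$ be the minor with the first $|J|$ rows and columns $J$, and let $\Delta_\emptyset=\Delta^\emptyset=1$. For $1\le a<b<c\le n$ define (all minors being those of $M$) $$Y_{abc}(M)=\frac{\Delta_{[a,b-1]\cup[c+1,n]}\,\Delta_{[a+1,b]\cup[c,n]}}{\Delta_{[a,b]\cup[c+1,n]}\,\Delta_{[a+1,b-1]\cup[c,n]}},\qquad \tilde Y_{abc}(M)=\frac{\Delta_{[1,a]\cup[b+1,c-1]}\,\Delta_{[1,a-1]\cup[b,c]}}{\Delta_{[1,a]\cup[b,c-1]}\,\Delta_{[1,a-1]\cup[b+1,c]}},$$ $$Y^{abc}(M)=\frac{\Delta^{[a,b]\cup[c+1,n]}\,\Delta^{[a+1,b-1]\cup[c,n]}}{\Delta^{[a,b-1]\cup[c+1,n]}\,\Delta^{[a+1,b]\cup[c,n]}},\qquad \tilde Y^{abc}(M)=\frac{\Delta^{[1,a]\cup[b,c-1]}\,\Delta^{[1,a-1]\cup[b+1,c]}}{\Delta^{[1,a]\cup[b+1,c-1]}\,\Delta^{[1,a-1]\cup[b,c]}}.$$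 For $x>0$ let $l(x)=\frac{6}{\pi^2}L\bigl(\frac{x}{1+x}\bigr)$, where $L(x)=\mathrm{Li}_2(x)+\frac12\log x\,\log(1-x)$, $0<x<1$, is the Rogers dilogarithm and $\mathrm{Li}_2(x)=\sum_{k\ge1}x^k/k^2$. Then for every $M\in N_n^+$ and all $s_1,s_2,s_3,s_4\in S_3$, with all sums over the integers $1\le a<b<c\le n$, $$\sum l\Bigl(\bigl(Y_{abc}(s_1(M))\bigr)^{\mathrm{sgn}(s_1)}\Bigr)=\sum l\Bigl(\bigl(\tilde Y^{abc}(s_2(M))\bigr)^{\mathrm{sgn}(s_2)}\Bigr)=\sum l\Bigl(\bigl(\tilde Y_{abc}(s_3(M))\bigr)^{\mathrm{sgn}(s_3)}\Bigr)=\sum l\Bigl(\bigl(Y^{abc}(s_4(M))\bigr)^{\mathrm{sgn}(s_4)}\Bigr).$$ -/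

import Mathlib

open scoped BigOperators

namespace TPDilog

/-! ### The normalized Rogers dilogarithm -/

/-- The dilogarithm `Li₂(x) = ∑_{k ≥ 1} x^k / k^2` (used only for `0 < x < 1`, where the
series converges absolutely). -/
noncomputable def Li2 (x : ℝ) : ℝ := ∑' k : ℕ, x ^ (k + 1) / ((k : ℝ) + 1) ^ 2

/-- The Rogers dilogarithm `L(x) = Li₂(x) + (1/2) log x log (1 - x)`, for `0 < x < 1`. -/
noncomputable def rogersL (x : ℝ) : ℝ := Li2 x + 1 / 2 * Real.log x * Real.log (1 - x)

/-- `l(x) = (6 / π^2) L(x / (1 + x))`, for `x > 0`. -/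
noncomputable def ell (x : ℝ) : ℝ := 6 / Real.pi ^ 2 * rogersL (x / (1 + x))

/-! ### Totally positive unipotent upper triangular matrices -/

/-- The group `N_n` of real unipotent upper triangular matrices, as a set of matrices. -/
def unipotentUpper (n : ℕ) : Set (Matrix (Fin n) (Fin n) ℝ) :=
  {M | (∀ i, M i i = 1) ∧ ∀ i j, j < i → M i j = 0}

/-- The variety `N_n^+`: elements of `N_n` all of whose minors that do not vanish identically
on `N_n` are positive. A minor of size `k` is given by strictly increasing
enumerations `r`, `c` of its rows and of its columns. -/
def totallyPositive (n : ℕ) : Set (Matrix (Fin n) (Fin n) ℝ) :=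
  {M | M ∈ unipotentUpper n ∧
    ∀ (k : ℕ) (r c : Fin k ↪o Fin n),
      (∃ H ∈ unipotentUpper n, (H.submatrix r c).det ≠ 0) → 0 < (M.submatrix r c).det}

/-! ### The maps `M ↦ M'` and `M ↦ M''` -/

/-- The permutation matrix of the longest element of `S_n`: with labels in `[1, n]`,
`P i j = 1` if `i + j = n + 1` and `P i j = 0` otherwise (rows and columns are labelled
from `0` here). -/
def revMatrix (n : ℕ) : Matrix (Fin n) (Fin n) ℝ :=
  Matrix.of fun i j => if (i : ℕ) + 1 + ((j : ℕ) + 1) = n + 1 then 1 else 0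

/-- `A`, `B` (both in `N_n^+`) and the diagonal matrix with entries `d` factorize
`P M P = A P D B`. -/
def IsGauss {n : ℕ} (M A B : Matrix (Fin n) (Fin n) ℝ) (d : Fin n → ℝ) : Prop :=
  A ∈ totallyPositive n ∧ B ∈ totallyPositive n ∧
    revMatrix n * M * revMatrix n = A * revMatrix n * Matrix.diagonal d * B

/-- The factorization `(M', M'', D_M)` of `P M P = M' P D_M M''`. -/
noncomputable def gaussTriple {n : ℕ} (M : Matrix (Fin n) (Fin n) ℝ) :
    Matrix (Fin n) (Fin n) ℝ × Matrix (Fin n) (Fin n) ℝ × (Fin n → ℝ) :=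
  Classical.epsilon fun q => IsGauss M q.1 q.2.1 q.2.2

/-- The map `M ↦ M'`. -/
noncomputable def prime {n : ℕ} (M : Matrix (Fin n) (Fin n) ℝ) : Matrix (Fin n) (Fin n) ℝ :=
  (gaussTriple M).1

/-- The map `M ↦ M''`. -/
noncomputable def dprime {n : ℕ} (M : Matrix (Fin n) (Fin n) ℝ) : Matrix (Fin n) (Fin n) ℝ :=
  (gaussTriple M).2.1

/-! ### The images of a matrix under the elements of `S_3` -/

/-- The generator `σ₁` of `S_3`. -/
def sigma1 : Equiv.Perm (Fin 3) := Equiv.swap 0 1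

/-- The generator `σ₂` of `S_3`. -/
def sigma2 : Equiv.Perm (Fin 3) := Equiv.swap 1 2

/-- `IsImage s M N`: the matrix `N` is (a value of) `s(M)`, where `σ₁(M) = M'`,
`σ₂(M) = M''` and a product acts by composition. For the longest element
`σ₁ σ₂ σ₁ = σ₂ σ₁ σ₂` both reduced words are admitted; the two matrices that they give
may differ. -/
inductive IsImage {n : ℕ} :
    Equiv.Perm (Fin 3) → Matrix (Fin n) (Fin n) ℝ → Matrix (Fin n) (Fin n) ℝ → Prop
  | id (M : Matrix (Fin n) (Fin n) ℝ) : IsImage 1 M M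
  | s1 (M : Matrix (Fin n) (Fin n) ℝ) : IsImage sigma1 M (prime M)
  | s2 (M : Matrix (Fin n) (Fin n) ℝ) : IsImage sigma2 M (dprime M)
  | s21 (M : Matrix (Fin n) (Fin n) ℝ) : IsImage (sigma2 * sigma1) M (dprime (prime M))
  | s12 (M : Matrix (Fin n) (Fin n) ℝ) : IsImage (sigma1 * sigma2) M (prime (dprime M))
  | s121 (M : Matrix (Fin n) (Fin n) ℝ) :
      IsImage (sigma1 * sigma2 * sigma1) M (prime (dprime (prime M)))
  | s212 (M : Matrix (Fin n) (Fin n) ℝ) :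
      IsImage (sigma2 * sigma1 * sigma2) M (dprime (prime (dprime M)))

/-- Every element of `S_3` has an image. -/
theorem exists_isImage {n : ℕ} (s : Equiv.Perm (Fin 3)) (M : Matrix (Fin n) (Fin n) ℝ) :
    ∃ N, IsImage s M N := by
  have h : s = 1 ∨ s = sigma1 ∨ s = sigma2 ∨ s = sigma2 * sigma1 ∨ s = sigma1 * sigma2 ∨
      s = sigma1 * sigma2 * sigma1 := by
    revert s
    decide
  rcases h with rfl | rfl | rfl | rfl | rfl | rfl
  · exact ⟨_, IsImage.id M⟩
  · exact ⟨_, IsImage.s1 M⟩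
  · exact ⟨_, IsImage.s2 M⟩
  · exact ⟨_, IsImage.s21 M⟩
  · exact ⟨_, IsImage.s12 M⟩
  · exact ⟨_, IsImage.s121 M⟩

/-! ### Flag minors and the four families of functions -/

/-- The indices in `Fin n` whose labels, counted from `1`, lie in `S`. -/
def labels (n : ℕ) (S : Finset ℕ) : Finset (Fin n) :=
  Finset.univ.filter fun i => (i : ℕ) + 1 ∈ S

theorem card_labels_le (n : ℕ) (S : Finset ℕ) : (labels n S).card ≤ n := by
  simpa using (labels n S).card_le_univ

/-- The first `|S ∩ [1, n]|` indices, in increasing order. -/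
def firstIdx (n : ℕ) (S : Finset ℕ) (k : Fin (labels n S).card) : Fin n :=
  ⟨k, lt_of_lt_of_le k.isLt (card_labels_le n S)⟩

/-- The last `|S ∩ [1, n]|` indices, in increasing order. -/
def lastIdx (n : ℕ) (S : Finset ℕ) (k : Fin (labels n S).card) : Fin n :=
  ⟨n - (labels n S).card + k, by have := card_labels_le n S; have := k.isLt; omega⟩

/-- The right flag minor `Δ_I(M)`: rows labelled by `I ⊆ [1, n]`, last `|I|` columns. -/
def rightMinor {n : ℕ} (M : Matrix (Fin n) (Fin n) ℝ) (I : Finset ℕ) : ℝ :=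
  (M.submatrix ((labels n I).orderEmbOfFin rfl) (lastIdx n I)).det

/-- The upper flag minor `Δ^J(M)`: first `|J|` rows, columns labelled by `J ⊆ [1, n]`. -/
def upperMinor {n : ℕ} (M : Matrix (Fin n) (Fin n) ℝ) (J : Finset ℕ) : ℝ :=
  (M.submatrix (firstIdx n J) ((labels n J).orderEmbOfFin rfl)).det

open Finset in
/-- `Y_{abc}(M)`. -/
noncomputable def Ylow {n : ℕ} (M : Matrix (Fin n) (Fin n) ℝ) (a b c : ℕ) : ℝ :=
  (rightMinor M (Icc a (b - 1) ∪ Icc (c + 1) n) * rightMinor M (Icc (a + 1) b ∪ Icc c n)) /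
    (rightMinor M (Icc a b ∪ Icc (c + 1) n) * rightMinor M (Icc (a + 1) (b - 1) ∪ Icc c n))

open Finset in
/-- `Ỹ_{abc}(M)`. -/
noncomputable def Ytlow {n : ℕ} (M : Matrix (Fin n) (Fin n) ℝ) (a b c : ℕ) : ℝ :=
  (rightMinor M (Icc 1 a ∪ Icc (b + 1) (c - 1)) * rightMinor M (Icc 1 (a - 1) ∪ Icc b c)) /
    (rightMinor M (Icc 1 a ∪ Icc b (c - 1)) * rightMinor M (Icc 1 (a - 1) ∪ Icc (b + 1) c))

open Finset in
/-- `Y^{abc}(M)`. -/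
noncomputable def Yup {n : ℕ} (M : Matrix (Fin n) (Fin n) ℝ) (a b c : ℕ) : ℝ :=
  (upperMinor M (Icc a b ∪ Icc (c + 1) n) * upperMinor M (Icc (a + 1) (b - 1) ∪ Icc c n)) /
    (upperMinor M (Icc a (b - 1) ∪ Icc (c + 1) n) * upperMinor M (Icc (a + 1) b ∪ Icc c n))

open Finset in
/-- `Ỹ^{abc}(M)`. -/
noncomputable def Ytup {n : ℕ} (M : Matrix (Fin n) (Fin n) ℝ) (a b c : ℕ) : ℝ :=
  (upperMinor M (Icc 1 a ∪ Icc b (c - 1)) * upperMinor M (Icc 1 (a - 1) ∪ Icc (b + 1) c)) /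
    (upperMinor M (Icc 1 a ∪ Icc (b + 1) (c - 1)) * upperMinor M (Icc 1 (a - 1) ∪ Icc b c))

/-- The discrete tetrahedron `T_n`: triples with `1 ≤ a < b < c ≤ n`. -/
def tetra (n : ℕ) : Finset (ℕ × ℕ × ℕ) :=
  (Finset.Icc 1 n ×ˢ Finset.Icc 1 n ×ˢ Finset.Icc 1 n).filter
    fun t => t.1 < t.2.1 ∧ t.2.1 < t.2.2

/-- `∑_{(a,b,c) ∈ T_n} l(Z(a,b,c)^{sgn s})`. -/
noncomputable def dilogSum (n : ℕ) (s : Equiv.Perm (Fin 3)) (Z : ℕ → ℕ → ℕ → ℝ) : ℝ :=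
  ∑ t ∈ tetra n, ell (Z t.1 t.2.1 t.2.2 ^ ((Equiv.Perm.sign s : ℤˣ) : ℤ))

end TPDilog

/-!
Up to a constant factor, the differential of `ell x` is
`log (1 + x) d log x - log x d log (1 + x)`. When `x` is one of the ratios of flag minors, the
three-term Plücker relation exhibits `1 + x` as a ratio of flag minors too, so the differential is
a sum of wedge products of pairs `(log Δ, d log Δ)`. Summed over the discrete tetrahedron, these
octahedral forms telescope to its faces, and the boundary terms of the families `Y_{abc}` and
`Ỹ_{abc}` coincide. Hence the difference of the two dilogarithm sums is constant along a
polynomial path in `N_n^+` that joins `M` to a unipotent matrix of binomial coefficients, where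
every ratio of either family is `(c - b) / (b - a)`.

Transposition in the antidiagonal exchanges right and upper flag minors and permutes the values
`Y_{abc}`, which settles the families with upper indices. Finally, the factorization
`P M P = M' P D M''` expresses the flag minors of `M'` as those of `M` for the reflected rows, up to
a factor depending only on the size. It therefore inverts the ratios and exchanges `Y` and `Ỹ`,
so `ell x + ell x⁻¹ = 2 * ell 1` gives the sign.
-/

namespace TPDilog

open Finset Matrix

/-! ### Sorted minors and the three-term Plücker relation -/

section SortedMinors

variable {R : Type*} [CommRing R]

lemma det_vandermonde_snoc {m : ℕ} (v : Fin m → R) (x : R) :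
    (vandermonde (Fin.snoc v x : Fin (m + 1) → R)).det
      = (vandermonde v).det * ∏ i, (x - v i) := by
  have hlast (i : Fin m) : Ioi i.castSucc = insert (Fin.last m) ((Ioi i).map Fin.castSuccEmb) := by
    ext j
    refine Fin.lastCases ?_ (fun j => ?_) j
    · simp
    · simpa using fun _ => Fin.le_last j.castSucc
  have hnot (i : Fin m) : Fin.last m ∉ (Ioi i).map Fin.castSuccEmb := by simp
  simp only [det_vandermonde, Fin.prod_univ_castSucc, hlast, prod_insert (hnot _),
    prod_mul_distrib, prod_map, Fin.coe_castSuccEmb, Fin.snoc_castSucc, Fin.snoc_last]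
  rw [← Fin.top_eq_last, Ioi_top, prod_empty, mul_one, mul_comm]

/-- The sign of the permutation that sorts the values of `f`, or `0` if `f` is not injective; it is
read off from the product of the differences `f j - f i` over `i < j`. -/
def sortSign {m : ℕ} (f : Fin m → ℕ) : ℤ :=
  (vandermonde fun i => (f i : ℤ)).det.sign

lemma sortSign_comp_perm {m : ℕ} (f : Fin m → ℕ) (σ : Equiv.Perm (Fin m)) :
    sortSign (f ∘ σ) = Equiv.Perm.sign σ * sortSign f := by
  have h : (vandermonde fun i => ((f ∘ σ) i : ℤ)).det
      = Equiv.Perm.sign σ * (vandermonde fun i => (f i : ℤ)).det :=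
    det_permute σ (vandermonde fun i => (f i : ℤ))
  rw [sortSign, h, Int.sign_mul, sortSign]
  rcases Int.units_eq_one_or (Equiv.Perm.sign σ) with hσ | hσ <;> simp [hσ]

lemma det_vandermonde_pos {K : Type*} [CommRing K] [LinearOrder K] [IsStrictOrderedRing K] {m : ℕ}
    {v : Fin m → K} (hv : StrictMono v) : 0 < (vandermonde v).det := by
  rw [det_vandermonde]
  exact prod_pos fun i _ => prod_pos fun j hj => sub_pos.2 (hv (mem_Ioi.1 hj))

lemma sortSign_of_strictMono {m : ℕ} {f : Fin m → ℕ} (hf : StrictMono f) : sortSign f = 1 :=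
  Int.sign_eq_one_of_pos (det_vandermonde_pos (Nat.strictMono_cast.comp hf))

lemma sortSign_mul_self {m : ℕ} {f : Fin m → ℕ} (hf : Function.Injective f) :
    sortSign f * sortSign f = 1 := by
  have h : (vandermonde fun i => (f i : ℤ)).det ≠ 0 :=
    det_vandermonde_ne_zero_iff.2 (Nat.cast_injective.comp hf)
  rw [sortSign, ← Int.sign_mul, Int.sign_eq_one_of_pos (mul_self_pos.2 h)]

lemma sortSign_snoc {m : ℕ} (s : Fin m → ℕ) (x : ℕ) :
    sortSign (Fin.snoc s x : Fin (m + 1) → ℕ) = sortSign s * (∏ i, ((x : ℤ) - s i)).sign := by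
  have h : (fun i => ((Fin.snoc s x : Fin (m + 1) → ℕ) i : ℤ))
      = Fin.snoc (fun i => (s i : ℤ)) (x : ℤ) := Fin.comp_snoc (fun a : ℕ => (a : ℤ)) s x
  rw [sortSign, h, det_vandermonde_snoc, Int.sign_mul, sortSign]

lemma sortSign_snoc_snoc {m : ℕ} {s : Fin m → ℕ} (hs : StrictMono s) {a b : ℕ} (hab : a < b) :
    sortSign (Fin.snoc (Fin.snoc s a : Fin (m + 1) → ℕ) b : Fin (m + 2) → ℕ)
      = sortSign (Fin.snoc s a : Fin (m + 1) → ℕ)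
        * sortSign (Fin.snoc s b : Fin (m + 1) → ℕ) := by
  have hba : ((b : ℤ) - a).sign = 1 := Int.sign_eq_one_of_pos (by omega)
  rw [sortSign_snoc _ b, sortSign_snoc s b, sortSign_of_strictMono hs, Fin.prod_univ_castSucc,
    Int.sign_mul]
  simp only [Fin.snoc_castSucc, Fin.snoc_last, hba, mul_one, one_mul]

/-- The determinant of the rows of `B` labelled by `I`, in increasing order (`0` unless there are as
many rows as columns). -/
def sortedMinor {m : ℕ} (B : ℕ → Fin m → R) (I : Finset ℕ) : R :=
  if h : #I = m then det (of fun i j => B (I.orderEmbOfFin h i) j) else 0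

lemma card_image_fin {m : ℕ} {f : Fin m → ℕ} (hf : Function.Injective f) :
    #(univ.image f) = m := by
  rw [card_image_of_injective _ hf, card_univ, Fintype.card_fin]

lemma det_rows_eq_sortSign_mul {m : ℕ} (B : ℕ → Fin m → R) {f : Fin m → ℕ}
    (hf : Function.Injective f) :
    det (of fun i j => B (f i) j) = sortSign f * sortedMinor B (univ.image f) := by
  have hc := card_image_fin hf
  set e := (univ.image f).orderEmbOfFin hc with he
  have hmem (i : Fin m) : ∃ k, e k = f i := by
    change f i ∈ Set.range e
    rw [he, range_orderEmbOfFin]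
    exact mem_image_of_mem f (mem_univ i)
  choose τ hτ using hmem
  have hτ_inj : Function.Injective τ := fun i j h => hf (by rw [← hτ i, ← hτ j, h])
  let σ : Equiv.Perm (Fin m) := Equiv.ofBijective τ (Finite.injective_iff_bijective.1 hτ_inj)
  have hfe : f = e ∘ σ := funext fun i => (hτ i).symm
  have hsign : sortSign f = Equiv.Perm.sign σ := by
    rw [hfe, sortSign_comp_perm, sortSign_of_strictMono e.strictMono, mul_one]
  rw [sortedMinor, dif_pos hc, ← he, hsign, ← det_permute, hfe]
  rfl

lemma sortedMinor_image {m : ℕ} (B : ℕ → Fin m → R) {f : Fin m → ℕ} (hf : StrictMono f) :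
    sortedMinor B (univ.image f) = det (of fun i j => B (f i) j) := by
  rw [det_rows_eq_sortSign_mul B hf.injective, sortSign_of_strictMono hf, Int.cast_one, one_mul]

lemma image_snoc {k : ℕ} (s : Fin k → ℕ) (a : ℕ) :
    univ.image (Fin.snoc s a : Fin (k + 1) → ℕ) = insert a (univ.image s) := by
  ext x
  simp [Fin.exists_fin_succ', eq_comm, or_comm]

lemma snoc_injective {k : ℕ} {s : Fin k → ℕ} (hs : Function.Injective s) {a : ℕ}
    (ha : a ∉ univ.image s) : Function.Injective (Fin.snoc s a : Fin (k + 1) → ℕ) :=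
  Fin.snoc_injective_iff.2 ⟨hs, by simpa using ha⟩

lemma exists_strictMono_image {S : Finset ℕ} {k : ℕ} (hS : #S = k) :
    ∃ s : Fin k → ℕ, StrictMono s ∧ univ.image s = S :=
  ⟨S.orderEmbOfFin hS, (S.orderEmbOfFin hS).strictMono, by
    apply coe_injective
    rw [coe_image, coe_univ, Set.image_univ, range_orderEmbOfFin]⟩

lemma det_smul_eq_sum_updateRow {m : Type*} [Fintype m] [DecidableEq m] (A : Matrix m m R)
    (v : m → R) : A.det • v = ∑ i, (A.updateRow i v).det • A i := by
  have h := mulVec_cramer Aᵀ v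
  rw [det_transpose] at h
  rw [← h]
  ext j
  simp [mulVec, dotProduct, cramer_transpose_apply, mul_comm]

/-- The matrix of size `k + 2` with rows `X`, `v`, `w`. -/
abbrev snocRows {k : ℕ} (X : Fin k → Fin (k + 2) → R) (v w : Fin (k + 2) → R) :
    Matrix (Fin (k + 2)) (Fin (k + 2)) R :=
  of (Fin.snoc (Fin.snoc X v : Fin (k + 1) → Fin (k + 2) → R) w)

-- Cramer's rule expresses `b` through the rows `X`, `a`, `c`, and `φ` only sees the last two.
lemma three_term_of_vanishes_on_rows {k : ℕ} {X : Fin k → Fin (k + 2) → R}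
    {φ : (Fin (k + 2) → R) →ₗ[R] R} (hφ : ∀ i, φ (X i) = 0) (a b c : Fin (k + 2) → R) :
    φ a * (snocRows X b c).det + φ c * (snocRows X a b).det = φ b * (snocRows X a c).det := by
  have hlast : (snocRows X a c).updateRow (Fin.last (k + 1)) b = snocRows X a b :=
    Fin.update_snoc_last (α := fun _ => Fin (k + 2) → R) _ _ _
  have hpred : (snocRows X a c).updateRow (Fin.last k).castSucc b = snocRows X b c := by
    refine (Fin.snoc_update (α := fun _ => Fin (k + 2) → R) _ _ _ _).symm.trans ?_
    rw [Fin.update_snoc_last]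
    rfl
  have hrow (i : Fin k) : snocRows X a c i.castSucc.castSucc = X i := by ext j; simp
  have hrow_a : snocRows X a c (Fin.last k).castSucc = a := by ext j; simp
  have hrow_c : snocRows X a c (Fin.last (k + 1)) = c := by ext j; simp
  have h := congrArg φ (det_smul_eq_sum_updateRow (snocRows X a c) b)
  rw [map_smul, map_sum, Fin.sum_univ_castSucc, Fin.sum_univ_castSucc] at h
  simp only [map_smul, hrow, hrow_a, hrow_c, hφ, hlast, hpred, smul_eq_mul, mul_zero,
    sum_const_zero, zero_add] at h
  linear_combination -h

lemma det_rows_plucker {k : ℕ} (X : Fin k → Fin (k + 2) → R) (a b c : Fin (k + 2) → R)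
    (e : Fin (k + 2)) :
    let D : (Fin (k + 2) → R) → R := fun v =>
      (submatrix (of (Fin.snoc X v : Fin (k + 1) → Fin (k + 2) → R)) id e.succAbove).det
    D a * (snocRows X b c).det + D c * (snocRows X a b).det = D b * (snocRows X a c).det := by
  intro D
  let φ : (Fin (k + 2) → R) →ₗ[R] R :=
    (detRowAlternating.toMultilinearMap.toLinearMap
      (Fin.snoc (fun i => X i ∘ e.succAbove) 0) (Fin.last k)).comp
      (LinearMap.funLeft R R e.succAbove)
  have hφD (v : Fin (k + 2) → R) : φ v = D v := by
    change det (Function.update (Fin.snoc (fun i => X i ∘ e.succAbove) 0 :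
      Fin (k + 1) → Fin (k + 1) → R) (Fin.last k) (v ∘ e.succAbove)) = D v
    rw [Fin.update_snoc_last]
    refine congrArg det (funext fun i => ?_)
    refine Fin.lastCases ?_ (fun i => ?_) i <;> ext j <;> simp
  simp only [← hφD]
  refine three_term_of_vanishes_on_rows (fun i => ?_) a b c
  rw [hφD]
  exact det_zero_of_row_eq (Fin.castSucc_lt_last i).ne (by ext j; simp)

theorem sortedMinor_plucker {k : ℕ} (B : ℕ → Fin (k + 2) → R) (e : Fin (k + 2))
    {S : Finset ℕ} (hS : #S = k) {a b c : ℕ} (ha : a ∉ S) (hb : b ∉ S) (hc : c ∉ S)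
    (hab : a < b) (hbc : b < c) :
    sortedMinor (fun i j => B i (e.succAbove j)) (insert a S)
          * sortedMinor B (insert b (insert c S))
        + sortedMinor (fun i j => B i (e.succAbove j)) (insert c S)
          * sortedMinor B (insert a (insert b S))
      = sortedMinor (fun i j => B i (e.succAbove j)) (insert b S)
          * sortedMinor B (insert a (insert c S)) := by
  obtain ⟨s, hs, rfl⟩ := exists_strictMono_image hS
  let ε (x : ℕ) : ℤ := sortSign (Fin.snoc s x : Fin (k + 1) → ℕ)
  have hε {x : ℕ} (hx : x ∉ univ.image s) : (ε x : R) * ε x = 1 := by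
    exact_mod_cast congrArg (Int.cast : ℤ → R) (sortSign_mul_self (snoc_injective hs.injective hx))
  have one_row {x : ℕ} (hx : x ∉ univ.image s) :
      (submatrix (of (Fin.snoc (fun i => B (s i)) (B x) : Fin (k + 1) → Fin (k + 2) → R)) id
        e.succAbove).det
        = ε x * sortedMinor (fun i j => B i (e.succAbove j)) (insert x (univ.image s)) := by
    rw [← image_snoc, ← det_rows_eq_sortSign_mul _ (snoc_injective hs.injective hx)]
    congr 1
    ext i j
    exact congrFun (congrFun (Fin.comp_snoc B s x) i).symm _
  have two_rows {x y : ℕ} (hx : x ∉ univ.image s) (hy : y ∉ univ.image s) (hxy : x < y) :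
      (snocRows (fun i => B (s i)) (B x) (B y)).det
        = ε x * ε y * sortedMinor B (insert x (insert y (univ.image s))) := by
    have hy' : y ∉ univ.image (Fin.snoc s x : Fin (k + 1) → ℕ) := by
      rw [image_snoc, mem_insert, not_or]
      exact ⟨hxy.ne', hy⟩
    rw [insert_comm, ← image_snoc, ← image_snoc, ← Int.cast_mul, ← sortSign_snoc_snoc hs hxy,
      ← det_rows_eq_sortSign_mul _ (snoc_injective (snoc_injective hs.injective hx) hy')]
    refine congrArg det (?_ : _ = B ∘ Fin.snoc (Fin.snoc s x : Fin (k + 1) → ℕ) y)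
    rw [Fin.comp_snoc, Fin.comp_snoc]
    rfl
  have h := det_rows_plucker (fun i => B (s i)) (B a) (B b) (B c) e
  simp only [one_row ha, one_row hb, one_row hc, two_rows hb hc hbc, two_rows ha hb hab,
    two_rows ha hc (hab.trans hbc)] at h
  have hunit : IsUnit ((ε a : R) * ε b * ε c) :=
    IsUnit.of_mul_eq_one (ε a * ε b * ε c) (by
      linear_combination ε b * ε b * ε c * ε c * hε ha + ε c * ε c * hε hb + hε hc)
  refine hunit.mul_left_cancel ?_
  linear_combination h

end SortedMinors

variable {n : ℕ}

/-! ### Total positivity in terms of minors -/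

/-- The entries of `M`, extended by zero to all natural numbers, so that minors can be indexed by
sets of natural numbers. -/
noncomputable def entry (M : Matrix (Fin n) (Fin n) ℝ) (i j : ℕ) : ℝ :=
  if h : i < n ∧ j < n then M ⟨i, h.1⟩ ⟨j, h.2⟩ else 0

@[simp] lemma entry_val (M : Matrix (Fin n) (Fin n) ℝ) (i j : Fin n) : entry M i j = M i j := by
  simp [entry]

lemma entry_of_lt {M : Matrix (Fin n) (Fin n) ℝ} (hM : M ∈ unipotentUpper n) {i j : ℕ}
    (h : j < i) : entry M i j = 0 := by
  rw [entry]
  split_ifs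
  · exact hM.2 _ _ h
  · rfl

lemma entry_self {M : Matrix (Fin n) (Fin n) ℝ} (hM : M ∈ unipotentUpper n) {i : ℕ}
    (h : i < n) : entry M i i = 1 := by
  rw [entry, dif_pos ⟨h, h⟩]
  exact hM.1 _

lemma submatrix_eq_entry (M : Matrix (Fin n) (Fin n) ℝ) {k : ℕ} (r c : Fin k → Fin n) :
    M.submatrix r c = of fun i j => entry M (r i) (c j) := by
  ext i j
  simp

lemma det_entry_eq_zero {M : Matrix (Fin n) (Fin n) ℝ} (hM : M ∈ unipotentUpper n) {k : ℕ}
    {r c : Fin k → ℕ} (hr : StrictMono r) (hc : StrictMono c) {i₀ : Fin k} (h : c i₀ < r i₀) :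
    det (of fun i j => entry M (r i) (c j)) = 0 := by
  rw [det_apply]
  refine sum_eq_zero fun σ _ => ?_
  suffices ∃ i, c i < r (σ i) by
    obtain ⟨i, hi⟩ := this
    rw [prod_eq_zero (mem_univ i) (entry_of_lt hM hi), smul_zero]
  -- Otherwise `σ` maps `{i ≤ i₀}` injectively into `{i < i₀}`.
  by_contra! hσ
  have hmaps : ∀ i ∈ Iic i₀, σ i ∈ Iio i₀ := fun i hi => by
    refine mem_Iio.2 (lt_of_not_ge fun hle => ?_)
    have := (hr.monotone hle).trans ((hσ i).trans (hc.monotone (mem_Iic.1 hi)))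
    omega
  simpa using card_le_card_of_injOn σ hmaps σ.injective.injOn

lemma exists_unipotent_det_ne_zero {k : ℕ} {r c : Fin k → Fin n} (hr : StrictMono r)
    (hc : StrictMono c) (h : ∀ i, r i ≤ c i) :
    ∃ H ∈ unipotentUpper n, (H.submatrix r c).det ≠ 0 := by
  classical
  let H : Matrix (Fin n) (Fin n) ℝ := of fun i j => if i = j ∨ ∃ l, r l = i ∧ c l = j then 1 else 0
  have hH : H ∈ unipotentUpper n := by
    refine ⟨by simp [H], fun i j hij => if_neg ?_⟩
    rintro (rfl | ⟨l, rfl, rfl⟩)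
    · exact lt_irrefl _ hij
    · exact absurd (h l) (not_le.2 hij)
  have hlower : (H.submatrix r c).IsLowerTriangular := fun i j (hij : i < j) => by
    refine if_neg ?_
    rintro (hrc | ⟨l, hl_row, hl_col⟩)
    · exact absurd (h j) (not_le.2 (hrc ▸ hr hij))
    · exact hij.ne ((hr.injective hl_row).symm.trans (hc.injective hl_col))
  have hdiag (i : Fin k) : H.submatrix r c i i = 1 := if_pos (Or.inr ⟨i, rfl, rfl⟩)
  refine ⟨H, hH, ?_⟩
  rw [det_of_isLowerTriangular _ hlower, prod_eq_one fun i _ => hdiag i]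
  exact one_ne_zero

lemma det_pos_of_le {M : Matrix (Fin n) (Fin n) ℝ} (hM : M ∈ totallyPositive n) {k : ℕ}
    {r c : Fin k → ℕ} (hr : StrictMono r) (hc : StrictMono c) (h : ∀ i, r i ≤ c i)
    (hn : ∀ i, c i < n) : 0 < det (of fun i j => entry M (r i) (c j)) := by
  let r' : Fin k ↪o Fin n := OrderEmbedding.ofStrictMono
    (fun i => ⟨r i, (h i).trans_lt (hn i)⟩) fun _ _ hij => hr hij
  let c' : Fin k ↪o Fin n := OrderEmbedding.ofStrictMono (fun i => ⟨c i, hn i⟩)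
    fun _ _ hij => hc hij
  have hpos := hM.2 k r' c' (exists_unipotent_det_ne_zero r'.strictMono c'.strictMono h)
  rwa [submatrix_eq_entry] at hpos

lemma det_nonneg {M : Matrix (Fin n) (Fin n) ℝ} (hM : M ∈ totallyPositive n) {k : ℕ}
    {r c : Fin k → ℕ} (hr : StrictMono r) (hc : StrictMono c)
    (hn : ∀ i, c i < n) : 0 ≤ det (of fun i j => entry M (r i) (c j)) := by
  by_cases! h : ∀ i, r i ≤ c i
  · exact (det_pos_of_le hM hr hc h hn).le
  · obtain ⟨i, hi⟩ := h
    exact (det_entry_eq_zero hM.1 hr hc hi).ge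

lemma mem_totallyPositive {M : Matrix (Fin n) (Fin n) ℝ} (hM : M ∈ unipotentUpper n)
    (h : ∀ (k : ℕ) (r c : Fin k → ℕ), StrictMono r → StrictMono c → (∀ i, r i ≤ c i) →
      (∀ i, c i < n) → 0 < det (of fun i j => entry M (r i) (c j))) :
    M ∈ totallyPositive n := by
  refine ⟨hM, fun k r c ⟨H, hH, hdet⟩ => ?_⟩
  rw [submatrix_eq_entry] at hdet ⊢
  have hr : StrictMono fun i => (r i : ℕ) := r.strictMono
  have hc : StrictMono fun i => (c i : ℕ) := c.strictMono
  refine h k _ _ hr hc (fun i => ?_) fun i => (c i).isLt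
  by_contra! hlt
  exact hdet (det_entry_eq_zero hH hr hc hlt)

lemma card_le_of_strictMono {k : ℕ} {f : Fin k → ℕ} (hf : StrictMono f) (hn : ∀ i, f i < n) :
    k ≤ n := by
  simpa using Fintype.card_le_of_injective (fun i => (⟨f i, hn i⟩ : Fin n)) fun i j h =>
    hf.injective (Fin.mk.inj h)

lemma strictMono_le_sub_add {k : ℕ} {f : Fin k → ℕ} (hf : StrictMono f) (hn : ∀ i, f i < n)
    (i : Fin k) : f i ≤ n - k + i := by
  have hcard : #(Ici i) ≤ #(Ico (f i) n) :=
    card_le_card_of_injOn f (fun j hj => by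
      simpa using ⟨hf.monotone (mem_Ici.1 hj), hn j⟩) hf.injective.injOn
  rw [Fin.card_Ici, Nat.card_Ico] at hcard
  have := card_le_of_strictMono hf hn
  have := hn i
  omega

/-- The minor with rows `I` and the last `#I` columns, with labels counted from `0`. -/
noncomputable def flagMinor (M : Matrix (Fin n) (Fin n) ℝ) (I : Finset ℕ) : ℝ :=
  sortedMinor (fun i (j : Fin #I) => entry M i (n - #I + j)) I

lemma flagMinor_eq (M : Matrix (Fin n) (Fin n) ℝ) {I : Finset ℕ} {k : ℕ} (h : #I = k) :
    flagMinor M I = sortedMinor (fun i (j : Fin k) => entry M i (n - k + j)) I := by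
  subst h
  rfl

lemma flagMinor_image (M : Matrix (Fin n) (Fin n) ℝ) {k : ℕ} {f : Fin k → ℕ}
    (hf : StrictMono f) :
    flagMinor M (univ.image f) = det (of fun i j => entry M (f i) (n - k + j)) := by
  rw [flagMinor_eq M (card_image_fin hf.injective), sortedMinor_image _ hf]

lemma image_subset_range {k : ℕ} {f : Fin k → ℕ} :
    univ.image f ⊆ range n ↔ ∀ i, f i < n := by
  simp [image_subset_iff]

lemma strictMono_add_val (a k : ℕ) : StrictMono fun i : Fin k => a + (i : ℕ) :=
  fun _ _ hij => Nat.add_lt_add_left hij a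

lemma flagMinor_pos {M : Matrix (Fin n) (Fin n) ℝ} (hM : M ∈ totallyPositive n) {I : Finset ℕ}
    (hI : I ⊆ range n) : 0 < flagMinor M I := by
  obtain ⟨k, hk⟩ : ∃ k, #I = k := ⟨_, rfl⟩
  obtain ⟨s, hs, rfl⟩ := exists_strictMono_image hk
  rw [image_subset_range] at hI
  have hcard := card_le_of_strictMono hs hI
  rw [flagMinor_image _ hs]
  exact det_pos_of_le hM hs (strictMono_add_val _ _) (strictMono_le_sub_add hs hI) fun i => by
    have := i.isLt
    omega

lemma strictMono_append_add_val {m d t : ℕ} {r : Fin m → ℕ} (hr : StrictMono r)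
    (hrd : ∀ i, r i < d) : StrictMono (Fin.append r fun i : Fin t => d + (i : ℕ)) := by
  intro i j
  refine Fin.addCases (fun i => ?_) (fun i => ?_) i <;>
    refine Fin.addCases (fun j => ?_) (fun j => ?_) j <;>
    simp only [Fin.append_left, Fin.append_right] <;> intro hij
  · exact hr (Fin.lt_def.2 hij)
  · exact (hrd i).trans_le (Nat.le_add_right _ _)
  · have : m + (i : ℕ) < j := hij
    omega
  · have : m + (i : ℕ) < m + j := hij
    omega

lemma image_append {m t : ℕ} (r : Fin m → ℕ) (s : Fin t → ℕ) :
    univ.image (Fin.append r s) = univ.image r ∪ univ.image s := by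
  ext x
  simp only [mem_image, mem_univ, true_and, mem_union]
  constructor
  · rintro ⟨i, rfl⟩
    refine Fin.addCases (fun i => Or.inl ⟨i, ?_⟩) (fun i => Or.inr ⟨i, ?_⟩) i
    · rw [Fin.append_left]
    · rw [Fin.append_right]
  · rintro (⟨i, rfl⟩ | ⟨i, rfl⟩)
    · exact ⟨Fin.castAdd t i, Fin.append_left _ _ _⟩
    · exact ⟨Fin.natAdd m i, Fin.append_right _ _ _⟩

lemma image_add_val (a k : ℕ) : univ.image (fun i : Fin k => a + (i : ℕ)) = Ico a (a + k) := by
  ext x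
  simp only [mem_image, mem_univ, true_and, mem_Ico]
  refine ⟨fun ⟨i, hi⟩ => by omega, fun h => ⟨⟨x - a, by omega⟩, Nat.add_sub_cancel' h.1⟩⟩

-- The tail of rows contributes a unipotent diagonal block, below a zero block.
lemma flagMinor_image_union_Ico {M : Matrix (Fin n) (Fin n) ℝ} (hM : M ∈ unipotentUpper n)
    {m d : ℕ} {r : Fin m → ℕ} (hr : StrictMono r) (hrd : ∀ i, r i < d + m) (h : d + m ≤ n) :
    flagMinor M (univ.image r ∪ Ico (d + m) n)
      = det (of fun i j : Fin m => entry M (r i) (d + j)) := by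
  obtain ⟨t, rfl⟩ := Nat.exists_eq_add_of_le h
  let r' : Fin (m + t) → ℕ := Fin.append r fun i : Fin t => d + m + (i : ℕ)
  let N : Matrix (Fin (m + t)) (Fin (m + t)) ℝ := of fun i j => entry M (r' i) (d + j)
  let T : Matrix (Fin t) (Fin t) ℝ := of fun i j => entry M (d + m + i) (d + m + j)
  have hT : T.det = 1 := by
    have hupper : T.IsUpperTriangular := fun i j (hij : j < i) =>
      entry_of_lt hM (Nat.add_lt_add_left (Fin.lt_def.1 hij) _)
    rw [det_of_isUpperTriangular hupper]
    exact prod_eq_one fun i _ => entry_self hM (by omega)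
  have hN : N.submatrix finSumFinEquiv finSumFinEquiv
      = fromBlocks (of fun i j : Fin m => entry M (r i) (d + j))
          (of fun (i : Fin m) (j : Fin t) => entry M (r i) (d + (m + j))) 0 T := by
    ext (i | i) (j | j)
    · simp [N, r']
    · simp [N, r']
    · simpa [N, r'] using entry_of_lt hM (by omega)
    · simp [N, r', T, add_assoc]
  rw [← image_add_val, ← image_append, flagMinor_image _ (strictMono_append_add_val hr hrd)]
  calc _ = N.det := by simp only [N, r', add_assoc, Nat.add_sub_cancel]
    _ = _ := by rw [← det_submatrix_equiv_self finSumFinEquiv, hN, det_fromBlocks_zero₂₁, hT,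
                  mul_one]

/-! ### A criterion for total positivity -/

lemma card_filter_lt_le_iff {k : ℕ} {c : Fin k → ℕ} (hc : StrictMono c) {x : ℕ} {i : Fin k} :
    #{j ∈ univ.image c | j < x} ≤ i ↔ x ≤ c i := by
  rw [filter_image, card_image_of_injective _ hc.injective]
  constructor
  · intro h
    by_contra! hlt
    have hsub : Iic i ⊆ ({l | c l < x} : Finset (Fin k)) := fun l hl =>
      mem_filter.2 ⟨mem_univ l, (hc.monotone (mem_Iic.1 hl)).trans_lt hlt⟩
    have hcard := card_le_card hsub
    rw [Fin.card_Iic] at hcard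
    omega
  · intro h
    rw [← Fin.card_Iio i]
    exact card_le_card fun l hl => mem_Iio.2 (hc.lt_iff_lt.1 ((mem_filter.1 hl).2.trans_le h))

/-- The columns of `M`, restricted to the rows `r`. -/
noncomputable def columns (M : Matrix (Fin n) (Fin n) ℝ) {k : ℕ} (r : Fin k → ℕ) (j : ℕ)
    (i : Fin k) : ℝ := entry M (r i) j

lemma sortedMinor_columns_image (M : Matrix (Fin n) (Fin n) ℝ) {k : ℕ} (r : Fin k → ℕ)
    {c : Fin k → ℕ} (hc : StrictMono c) :
    sortedMinor (columns M r) (univ.image c) = det (of fun i j => entry M (r i) (c j)) := by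
  rw [sortedMinor_image _ hc, ← det_transpose]
  rfl

/-- All minors of `M` with columns `J` that can be nonzero are positive; the condition on the rows
`r` says that `r i` is at most the `i`-th element of `J`. -/
def ColumnMinorsPos (M : Matrix (Fin n) (Fin n) ℝ) (J : Finset ℕ) : Prop :=
  ∀ ⦃k : ℕ⦄ (r : Fin k → ℕ), #J = k → StrictMono r → (∀ i, #{j ∈ J | j < r i} ≤ i) →
    0 < sortedMinor (columns M r) J

lemma ColumnMinorsPos.sortedMinor_nonneg {M : Matrix (Fin n) (Fin n) ℝ}
    (hM : M ∈ unipotentUpper n) {J : Finset ℕ} (hJ : ColumnMinorsPos M J) {k : ℕ}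
    (hk : #J = k) {r : Fin k → ℕ} (hr : StrictMono r) : 0 ≤ sortedMinor (columns M r) J := by
  by_cases! h : ∀ i, #{j ∈ J | j < r i} ≤ i
  · exact (hJ r hk hr h).le
  · obtain ⟨c, hc, rfl⟩ := exists_strictMono_image hk
    obtain ⟨i, hi⟩ := h
    rw [lt_iff_not_ge, card_filter_lt_le_iff hc, not_le] at hi
    rw [sortedMinor_columns_image M r hc, det_entry_eq_zero hM hr hc hi]

lemma columnMinorsPos_Ico {M : Matrix (Fin n) (Fin n) ℝ} (hM : M ∈ unipotentUpper n)
    (hf : ∀ I ⊆ range n, 0 < flagMinor M I) {lo hi : ℕ} (h : lo ≤ hi) (hn : hi ≤ n) :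
    ColumnMinorsPos M (Ico lo hi) := by
  intro k r hk hr hle
  rw [Nat.card_Ico] at hk
  obtain rfl : lo + k = hi := by omega
  have hc := strictMono_add_val lo k
  rw [← image_add_val] at hle ⊢
  simp only [card_filter_lt_le_iff hc] at hle
  rw [sortedMinor_columns_image M r hc,
    ← flagMinor_image_union_Ico hM hr (fun i => (hle i).trans_lt (by omega)) hn]
  refine hf _ (union_subset (image_subset_range.2 fun i => ?_) fun x hx => ?_)
  · have := hle i
    omega
  · exact mem_range.2 (mem_Ico.1 hx).2

lemma card_insert_insert {S : Finset ℕ} {a b : ℕ} (ha : a ∉ S) (hb : b ∉ S) (hab : a ≠ b) :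
    #(insert a (insert b S)) = #S + 2 := by
  rw [card_insert_of_notMem (by simp [ha, hab]), card_insert_of_notMem hb]

lemma card_filter_insert_le {S T : Finset ℕ} {a b x : ℕ} (hab : a ≤ b) (ha : a ∉ S)
    (hT : insert a S ⊆ T) : #{j ∈ insert b S | j < x} ≤ #{j ∈ T | j < x} := by
  refine le_trans ?_ (card_le_card (filter_subset_filter _ hT))
  rw [filter_insert, filter_insert]
  split_ifs with hb hax hax
  · rw [card_insert_of_notMem (s := {j ∈ S | j < x}) (a := a) (by simp [ha])]
    exact card_insert_le _ _
  · omega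
  · exact card_le_card (subset_insert _ _)
  · exact le_rfl

-- In the Plücker relation for `lo < p < hi`, every factor except the wanted one has its columns
-- in a smaller window, or is smaller in size.
lemma columnMinorsPos_of_gap {M : Matrix (Fin n) (Fin n) ℝ} (hM : M ∈ unipotentUpper n)
    {S : Finset ℕ} {lo p hi : ℕ} (hS : S ⊆ Ioo lo hi) (hpS : p ∉ S) (hp : p ∈ Ioo lo hi)
    (small : ∀ x ∈ Icc lo hi, x ∉ S → ColumnMinorsPos M (insert x S))
    (right : ColumnMinorsPos M (insert p (insert hi S)))
    (left : ColumnMinorsPos M (insert lo (insert p S))) :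
    ColumnMinorsPos M (insert lo (insert hi S)) := by
  obtain ⟨hlop, hphi⟩ := mem_Ioo.1 hp
  have hlo : lo ∉ S := fun h => left_notMem_Ioo (hS h)
  have hhi : hi ∉ S := fun h => right_notMem_Ioo (hS h)
  intro k r hk hr hle
  obtain rfl : #S + 2 = k := (card_insert_insert hlo hhi (hlop.trans hphi).ne).symm.trans hk
  have one_column (x : ℕ) (hx : x ∈ Icc lo hi) (hxS : x ∉ S) :
      0 < sortedMinor (columns M (r ∘ Fin.castSucc)) (insert x S) :=
    small x hx hxS _ (card_insert_of_notMem hxS) (hr.comp Fin.strictMono_castSucc) fun i =>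
      (card_filter_insert_le (mem_Icc.1 hx).1 hlo
        (insert_subset_insert _ (subset_insert _ _))).trans (hle i.castSucc)
  have h_lo := one_column lo (mem_Icc.2 ⟨le_rfl, by omega⟩) hlo
  have h_hi := one_column hi (mem_Icc.2 ⟨by omega, le_rfl⟩) hhi
  have h_p := one_column p (mem_Icc.2 ⟨by omega, by omega⟩) hpS
  have h_right := right r (card_insert_insert hpS hhi hphi.ne) hr fun i =>
    (card_filter_insert_le hlop.le (by simp [hlo, (hlop.trans hphi).ne]) subset_rfl).trans (hle i)
  have h_left := left.sortedMinor_nonneg hM (card_insert_insert hlo hpS hlop.ne) hr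
  have hP := sortedMinor_plucker (columns M r) (Fin.last (#S + 1)) rfl hlo hpS hhi hlop hphi
  simp only [Fin.succAbove_last] at hP
  refine pos_of_mul_pos_right (lt_of_lt_of_eq ?_ hP) h_p.le
  exact add_pos_of_pos_of_nonneg (mul_pos h_lo h_right) (mul_nonneg h_hi.le h_left)

lemma exists_eq_insert_ends {J : Finset ℕ} {lo hi : ℕ} (hJ : J ⊆ Icc lo hi) (hlo : lo ∈ J)
    (hhi : hi ∈ J) : ∃ S ⊆ Ioo lo hi, J = insert lo (insert hi S) := by
  refine ⟨{x ∈ J | lo < x ∧ x < hi}, fun x hx => mem_Ioo.2 (mem_filter.1 hx).2, ?_⟩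
  ext x
  simp only [mem_insert, mem_filter]
  constructor
  · intro hx
    have := mem_Icc.1 (hJ hx)
    simp only [hx, true_and]
    omega
  · rintro (rfl | rfl | hx)
    exacts [hlo, hhi, hx.1]

lemma columnMinorsPos_insert_ends {M : Matrix (Fin n) (Fin n) ℝ} (hM : M ∈ unipotentUpper n)
    {S : Finset ℕ} {lo p hi : ℕ} (hS : S ⊆ Ioo lo hi) (hpS : p ∉ S) (hp : p ∈ Ioo lo hi)
    (ih : ∀ {J : Finset ℕ} {lo' hi' : ℕ}, (∀ x ∈ J, lo' ≤ x ∧ x < hi') →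
      #J + (hi' - lo') < #S + 2 + (hi + 1 - lo) → lo' ≤ hi' → hi' ≤ hi + 1 → ColumnMinorsPos M J) :
    ColumnMinorsPos M (insert lo (insert hi S)) := by
  have hS' (x : ℕ) (hx : x ∈ S) : lo < x ∧ x < hi := mem_Ioo.1 (hS hx)
  have hlo : lo ∉ S := fun h => left_notMem_Ioo (hS h)
  have hhi : hi ∉ S := fun h => right_notMem_Ioo (hS h)
  have hp' := mem_Ioo.1 hp
  refine columnMinorsPos_of_gap hM hS hpS hp (fun x hx hxS => ?_) ?_ ?_
  · have hcard := card_insert_of_notMem hxS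
    have hx := mem_Icc.1 hx
    refine ih (lo' := lo) (hi' := hi + 1) ?_ (by omega) (by omega) le_rfl
    simp only [forall_mem_insert]
    exact ⟨by omega, fun y hy => by have := hS' y hy; omega⟩
  · have hcard := card_insert_insert hpS hhi hp'.2.ne
    refine ih (lo' := lo + 1) (hi' := hi + 1) ?_ (by omega) (by omega) le_rfl
    simp only [forall_mem_insert]
    exact ⟨by omega, by omega, fun y hy => by have := hS' y hy; omega⟩
  · have hcard := card_insert_insert hlo hpS hp'.1.ne
    refine ih (lo' := lo) (hi' := hi) ?_ (by omega) (by omega) (by omega)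
    simp only [forall_mem_insert]
    exact ⟨by omega, by omega, fun y hy => by have := hS' y hy; omega⟩

lemma columnMinorsPos_of_flagMinor_pos {M : Matrix (Fin n) (Fin n) ℝ} (hM : M ∈ unipotentUpper n)
    (hf : ∀ I ⊆ range n, 0 < flagMinor M I) (N : ℕ) {lo hi : ℕ} {J : Finset ℕ}
    (hJ : J ⊆ Ico lo hi) (hN : #J + (hi - lo) ≤ N) (hlohi : lo ≤ hi) (hn : hi ≤ n) :
    ColumnMinorsPos M J := by
  induction N using Nat.strong_induction_on generalizing lo hi J with
  | _ N ih =>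
  have window {J' : Finset ℕ} {lo' hi' : ℕ} (hsub : ∀ x ∈ J', lo' ≤ x ∧ x < hi')
      (hlt : #J' + (hi' - lo') < #J + (hi - lo)) (hlohi' : lo' ≤ hi') (hhi' : hi' ≤ hi) :
      ColumnMinorsPos M J' :=
    ih (#J' + (hi' - lo')) (by omega) (fun x hx => mem_Ico.2 (hsub x hx)) le_rfl hlohi'
      (hhi'.trans hn)
  by_cases hJI : J = Ico lo hi
  · exact hJI ▸ columnMinorsPos_Ico hM hf hlohi hn
  obtain ⟨p, hpI, hpJ⟩ := exists_of_ssubset (ssubset_of_subset_of_ne hJ hJI)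
  have hp := mem_Ico.1 hpI
  obtain ⟨hi, rfl⟩ : ∃ m, hi = m + 1 := ⟨hi - 1, by omega⟩
  have hJ' (x : ℕ) (hx : x ∈ J) : lo ≤ x ∧ x < hi + 1 := mem_Ico.1 (hJ hx)
  by_cases hlo : lo ∈ J
  swap
  · refine window (lo' := lo + 1) (hi' := hi + 1) (fun x hx => ?_) (by omega) (by omega) le_rfl
    have := hJ' x hx
    have : x ≠ lo := ne_of_mem_of_not_mem hx hlo
    omega
  by_cases hhi : hi ∈ J
  swap
  · refine window (lo' := lo) (hi' := hi) (fun x hx => ?_) (by omega) (by omega) (by omega)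
    have := hJ' x hx
    have : x ≠ hi := ne_of_mem_of_not_mem hx hhi
    omega
  obtain ⟨S, hS, rfl⟩ := exists_eq_insert_ends hJ hlo hhi
  simp only [mem_insert, not_or] at hpJ
  rw [card_insert_insert (fun h => left_notMem_Ioo (hS h)) (fun h => right_notMem_Ioo (hS h))
    (by omega)] at window
  exact columnMinorsPos_insert_ends hM hS hpJ.2.2 (mem_Ioo.2 (by omega)) window

theorem mem_totallyPositive_of_flagMinor_pos {M : Matrix (Fin n) (Fin n) ℝ}
    (hM : M ∈ unipotentUpper n) (hf : ∀ I ⊆ range n, 0 < flagMinor M I) :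
    M ∈ totallyPositive n := by
  refine mem_totallyPositive hM fun k r c hr hc hle hn => ?_
  have hsub : univ.image c ⊆ Ico 0 n := by
    rw [← range_eq_Ico]
    exact image_subset_range.2 hn
  have hpos := columnMinorsPos_of_flagMinor_pos hM hf _ hsub le_rfl n.zero_le le_rfl r
    (card_image_fin hc.injective) hr fun i => (card_filter_lt_le_iff hc).2 (hle i)
  rwa [sortedMinor_columns_image M r hc] at hpos

/-! ### The three-term relation for flag minors and a base point -/

lemma flagMinor_plucker (M : Matrix (Fin n) (Fin n) ℝ) {S : Finset ℕ} (hS : #S + 2 ≤ n)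
    {a b c : ℕ} (ha : a ∉ S) (hb : b ∉ S) (hc : c ∉ S) (hab : a < b) (hbc : b < c) :
    flagMinor M (insert a S) * flagMinor M (insert b (insert c S))
        + flagMinor M (insert a (insert b S)) * flagMinor M (insert c S)
      = flagMinor M (insert a (insert c S)) * flagMinor M (insert b S) := by
  let B (i : ℕ) (j : Fin (#S + 2)) : ℝ := entry M i (n - (#S + 2) + j)
  have hone {x : ℕ} (hx : x ∉ S) : flagMinor M (insert x S)
      = sortedMinor (fun i j => B i (Fin.succAbove 0 j)) (insert x S) := by
    rw [flagMinor_eq M (card_insert_of_notMem hx)]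
    congr 1
    ext i j
    simp only [B, Fin.zero_succAbove, Fin.val_succ]
    congr 1
    omega
  have htwo {x y : ℕ} (hx : x ∉ S) (hy : y ∉ S) (hxy : x < y) :
      flagMinor M (insert x (insert y S)) = sortedMinor B (insert x (insert y S)) :=
    flagMinor_eq M (card_insert_insert hx hy hxy.ne)
  rw [hone ha, hone hb, hone hc, htwo hb hc hbc, htwo ha hb hab, htwo ha hc (hab.trans hbc)]
  linear_combination sortedMinor_plucker B 0 rfl ha hb hc hab hbc

/-- The cross ratio of flag minors attached to a set `S` of rows and three further rows; each of
the four families of functions consists of such ratios or of their inverses. -/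
noncomputable def flagRatio (M : Matrix (Fin n) (Fin n) ℝ) (S : Finset ℕ) (a b c : ℕ) : ℝ :=
  (flagMinor M (insert a S) * flagMinor M (insert b (insert c S))) /
    (flagMinor M (insert a (insert b S)) * flagMinor M (insert c S))

/-- The totally positive matrix with binomial entries at which the cross ratios are explicit. -/
noncomputable def binomMatrix (n : ℕ) : Matrix (Fin n) (Fin n) ℝ :=
  of fun i j => ((n - 1 - i).choose (n - 1 - j) : ℝ)

lemma binomMatrix_mem_unipotentUpper : binomMatrix n ∈ unipotentUpper n := by
  refine ⟨fun i => by simp [binomMatrix], fun i j hij => ?_⟩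
  have : (j : ℕ) < i := hij
  rw [binomMatrix, of_apply, Nat.choose_eq_zero_of_lt (by omega), Nat.cast_zero]

lemma det_choose_mul {k : ℕ} (v : Fin k → ℕ) :
    det (of fun i j : Fin k => ((v i).choose j : ℝ)) * ∏ j : Fin k, (Nat.factorial j : ℝ)
      = (vandermonde fun i => (v i : ℝ)).det := by
  rw [det_eval_matrixOfPolynomials_eq_det_vandermonde (fun i => (v i : ℝ))
    (fun j : Fin k => descPochhammer ℝ j) (fun i => descPochhammer_natDegree ℝ i)
    (fun i => monic_descPochhammer ℝ i), mul_comm, ← det_mul_row]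
  congr 1
  ext i j
  simp only [of_apply]
  rw [descPochhammer_eval_eq_descFactorial, Nat.descFactorial_eq_factorial_mul_choose]
  push_cast
  rfl

lemma det_entry_binomMatrix_mul {k : ℕ} (hk : k ≤ n) {f : Fin k → ℕ} (hf : ∀ i, f i < n) :
    det (of fun i j : Fin k => entry (binomMatrix n) (f i) (n - k + j))
        * ∏ j : Fin k, (Nat.factorial j : ℝ)
      = (vandermonde fun i => ((n - 1 - f i.rev : ℕ) : ℝ)).det := by
  rw [← det_choose_mul, ← det_submatrix_equiv_self Fin.revPerm]
  congr 2
  ext i j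
  have hcol : n - k + (j.rev : ℕ) < n := by have := j.rev.isLt; omega
  simp only [submatrix_apply, of_apply, Fin.revPerm_apply]
  rw [entry, dif_pos ⟨hf _, hcol⟩, binomMatrix, of_apply]
  congr 2
  simp only [Fin.val_rev]
  omega

lemma binomMatrix_mem : binomMatrix n ∈ totallyPositive n := by
  refine mem_totallyPositive_of_flagMinor_pos binomMatrix_mem_unipotentUpper fun I hI => ?_
  obtain ⟨k, hk⟩ : ∃ k, #I = k := ⟨_, rfl⟩
  obtain ⟨s, hs, rfl⟩ := exists_strictMono_image hk
  rw [image_subset_range] at hI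
  have hrev : StrictMono fun i : Fin k => n - 1 - s i.rev := fun i j hij => by
    have hlt := hs (Fin.rev_lt_rev.2 hij)
    have hle := hI i.rev
    change n - 1 - s i.rev < n - 1 - s j.rev
    omega
  rw [flagMinor_image _ hs]
  refine pos_of_mul_pos_left (b := ∏ j : Fin k, (Nat.factorial j : ℝ)) ?_
    (prod_nonneg fun j _ => Nat.cast_nonneg _)
  rw [det_entry_binomMatrix_mul (card_le_of_strictMono hs hI) hI]
  exact det_vandermonde_pos (Nat.strictMono_cast.comp hrev)

lemma abs_det_vandermonde_sub_rev {k N : ℕ} {f : Fin k → ℕ} (hf : ∀ i, f i ≤ N) :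
    |(vandermonde fun i => ((N - f i.rev : ℕ) : ℝ)).det|
      = |(vandermonde fun i => (f i : ℝ)).det| := by
  have hrev : (vandermonde fun i => ((N - f i.rev : ℕ) : ℝ))
      = (vandermonde fun i => ((N - f i : ℕ) : ℝ)).submatrix Fin.revPerm (Equiv.refl _) := rfl
  rw [hrev, abs_det_submatrix_equiv_equiv, det_vandermonde, det_vandermonde]
  simp only [abs_prod]
  refine prod_congr rfl fun i _ => prod_congr rfl fun j _ => ?_
  rw [Nat.cast_sub (hf i), Nat.cast_sub (hf j), sub_sub_sub_cancel_left, abs_sub_comm]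

lemma flagMinor_binomMatrix_mul {k : ℕ} {f : Fin k → ℕ} (hf : Function.Injective f)
    (hn : ∀ i, f i < n) :
    flagMinor (binomMatrix n) (univ.image f) * ∏ j : Fin k, (Nat.factorial j : ℝ)
      = |(vandermonde fun i => (f i : ℝ)).det| := by
  have hk : k ≤ n := by
    simpa [card_image_fin hf] using card_le_card (image_subset_range.2 hn)
  have hsign : |((sortSign f : ℤ) : ℝ)| = 1 := by
    rcases mul_self_eq_one_iff.1 (sortSign_mul_self hf) with h | h <;> simp [h]
  have hdet := congrArg abs (det_rows_eq_sortSign_mul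
    (fun i (j : Fin k) => entry (binomMatrix n) i (n - k + j)) hf)
  rw [abs_mul, hsign, one_mul, ← flagMinor_eq _ (card_image_fin hf),
    abs_of_pos (flagMinor_pos binomMatrix_mem (image_subset_range.2 hn))] at hdet
  have hfact : |∏ j : Fin k, (Nat.factorial j : ℝ)| = ∏ j : Fin k, (Nat.factorial j : ℝ) :=
    abs_of_nonneg (prod_nonneg fun j _ => Nat.cast_nonneg _)
  rw [← hdet, ← hfact, ← abs_mul, det_entry_binomMatrix_mul hk hn,
    abs_det_vandermonde_sub_rev fun i => Nat.le_sub_one_of_lt (hn i)]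

lemma abs_det_vandermonde_natCast_snoc {k : ℕ} (s : Fin k → ℕ) (x : ℕ) :
    |(vandermonde fun i => ((Fin.snoc s x : Fin (k + 1) → ℕ) i : ℝ)).det|
      = |(vandermonde fun i => (s i : ℝ)).det| * ∏ i, |(x : ℝ) - s i| := by
  have h : (fun i => ((Fin.snoc s x : Fin (k + 1) → ℕ) i : ℝ))
      = Fin.snoc (fun i => (s i : ℝ)) (x : ℝ) := Fin.comp_snoc (fun a : ℕ => (a : ℝ)) s x
  rw [h, det_vandermonde_snoc, abs_mul, abs_prod]

lemma flagMinor_binomMatrix_insert_mul {k : ℕ} {s : Fin k → ℕ} (hs : Function.Injective s)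
    (hn : univ.image s ⊆ range n) {x : ℕ} (hx : x ∉ univ.image s) (hxn : x < n) :
    flagMinor (binomMatrix n) (insert x (univ.image s)) * ∏ j : Fin (k + 1), (Nat.factorial j : ℝ)
      = |(vandermonde fun i => (s i : ℝ)).det| * ∏ i, |(x : ℝ) - s i| := by
  have hsub : univ.image (Fin.snoc s x : Fin (k + 1) → ℕ) ⊆ range n :=
    image_snoc s x ▸ insert_subset (mem_range.2 hxn) hn
  rw [← image_snoc, flagMinor_binomMatrix_mul (snoc_injective hs hx) (image_subset_range.1 hsub),
    abs_det_vandermonde_natCast_snoc]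

lemma flagMinor_binomMatrix_insert_insert_mul {k : ℕ} {s : Fin k → ℕ} (hs : Function.Injective s)
    (hn : univ.image s ⊆ range n) {x y : ℕ} (hx : x ∉ univ.image s) (hy : y ∉ univ.image s)
    (hxy : x < y) (hyn : y < n) :
    flagMinor (binomMatrix n) (insert x (insert y (univ.image s)))
        * ∏ j : Fin (k + 2), (Nat.factorial j : ℝ)
      = |(vandermonde fun i => (s i : ℝ)).det| * (∏ i, |(x : ℝ) - s i|) * (∏ i, |(y : ℝ) - s i|)
        * (y - x) := by
  have hy' : y ∉ univ.image (Fin.snoc s x : Fin (k + 1) → ℕ) := by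
    rw [image_snoc, mem_insert, not_or]
    exact ⟨hxy.ne', hy⟩
  have hsub : univ.image (Fin.snoc s x : Fin (k + 1) → ℕ) ⊆ range n :=
    image_snoc s x ▸ insert_subset (mem_range.2 (hxy.trans hyn)) hn
  rw [insert_comm, ← image_snoc,
    flagMinor_binomMatrix_insert_mul (snoc_injective hs hx) hsub hy' hyn,
    abs_det_vandermonde_natCast_snoc,
    Fin.prod_univ_castSucc, Fin.snoc_last, abs_of_pos (sub_pos.2 (Nat.cast_lt.2 hxy))]
  simp only [Fin.snoc_castSucc]
  ring

lemma flagRatio_binomMatrix {S : Finset ℕ} (hS : S ⊆ range n) {a b c : ℕ} (ha : a ∉ S)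
    (hb : b ∉ S) (hc : c ∉ S) (hab : a < b) (hbc : b < c) (hcn : c < n) :
    flagRatio (binomMatrix n) S a b c = ((c : ℝ) - b) / (b - a) := by
  obtain ⟨k, hk⟩ : ∃ k, #S = k := ⟨_, rfl⟩
  obtain ⟨s, hs, rfl⟩ := exists_strictMono_image hk
  have hfact (m : ℕ) : (∏ j : Fin m, (Nat.factorial j : ℝ)) ≠ 0 :=
    prod_ne_zero_iff.2 fun j _ => Nat.cast_ne_zero.2 (Nat.factorial_ne_zero j)
  have hone {x : ℕ} (hx : x ∉ univ.image s) (hxn : x < n) := eq_div_of_mul_eq (hfact _)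
    (flagMinor_binomMatrix_insert_mul hs.injective hS hx hxn)
  have htwo {x y : ℕ} (hx : x ∉ univ.image s) (hy : y ∉ univ.image s) (hxy : x < y) (hyn : y < n) :=
    eq_div_of_mul_eq (hfact _)
      (flagMinor_binomMatrix_insert_insert_mul hs.injective hS hx hy hxy hyn)
  have hV : |(vandermonde fun i => (s i : ℝ)).det| ≠ 0 := abs_ne_zero.2
    (det_vandermonde_ne_zero_iff.2 (Nat.cast_injective.comp hs.injective))
  have hw {x : ℕ} (hx : x ∉ univ.image s) : ∏ i, |(x : ℝ) - s i| ≠ 0 :=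
    prod_ne_zero_iff.2 fun i _ => abs_ne_zero.2 <| sub_ne_zero.2 fun h =>
      hx (Nat.cast_injective h ▸ mem_image_of_mem s (mem_univ i))
  have hwa := hw ha
  have hwb := hw hb
  have hwc := hw hc
  have hfact_one := hfact (k + 1)
  have hfact_two := hfact (k + 2)
  have hba : (b : ℝ) - a ≠ 0 := (sub_pos.2 (Nat.cast_lt.2 hab)).ne'
  rw [flagRatio, hone ha (by omega), hone hc hcn, htwo hb hc hbc hcn, htwo ha hb hab (by omega)]
  field_simp

/-! ### Products and polynomial paths of totally positive matrices -/

/-- The Cauchy–Binet formula, symmetrized over all choices of columns. -/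
lemma factorial_mul_det_mul {R m ι : Type*} [CommRing R] [Fintype m] [DecidableEq m] [Fintype ι]
    (A : Matrix m ι R) (B : Matrix ι m R) :
    ((Fintype.card m).factorial : R) * det (A * B)
      = ∑ p : m → ι, det (A.submatrix id p) * det (B.submatrix p id) := by
  classical
  have hexpand : det (A * B) = ∑ p : m → ι, det (A.submatrix id p) * ∏ i, B (p i) i := by
    simp only [det_apply', mul_apply, prod_univ_sum, mul_sum, Fintype.piFinset_univ]
    rw [sum_comm]
    refine sum_congr rfl fun p _ => ?_
    rw [sum_mul]
    refine sum_congr rfl fun σ _ => ?_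
    rw [prod_mul_distrib, mul_assoc]
    rfl
  have hperm (τ : Equiv.Perm m) : det (A * B) = ∑ p : m → ι,
      det (A.submatrix id p) * (((Equiv.Perm.sign τ : ℤ) : R) * ∏ i, B (p (τ i)) i) := by
    rw [hexpand, ← Equiv.sum_comp (Equiv.arrowCongr τ.symm (Equiv.refl ι))]
    refine sum_congr rfl fun p _ => ?_
    have hcols : A.submatrix id ((Equiv.arrowCongr τ.symm (Equiv.refl ι)) p)
        = (A.submatrix id p).submatrix id τ := rfl
    rw [hcols, det_permute']
    simp only [Equiv.arrowCongr_apply, Equiv.symm_symm, Equiv.coe_refl, Function.comp_apply, id]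
    ring
  have hcard :
      ∑ _τ : Equiv.Perm m, det (A * B) = ((Fintype.card m).factorial : R) * det (A * B) := by
    rw [sum_const, card_univ, Fintype.card_perm, nsmul_eq_mul]
  rw [← hcard, sum_congr rfl fun τ _ => hperm τ, sum_comm]
  refine sum_congr rfl fun p _ => ?_
  rw [← mul_sum]
  congr 1
  rw [det_apply']
  rfl

lemma isUpperTriangular_mul_apply_self {ι R : Type*} [Fintype ι] [LinearOrder ι]
    [NonUnitalNonAssocSemiring R] {A B : Matrix ι ι R} (hA : A.IsUpperTriangular)
    (hB : B.IsUpperTriangular) (i : ι) : (A * B) i i = A i i * B i i := by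
  rw [mul_apply]
  refine Fintype.sum_eq_single i fun j hj => ?_
  rcases hj.lt_or_gt with hji | hij
  · rw [hA hji, zero_mul]
  · rw [hB hij, mul_zero]

lemma unipotentUpper_mul {M N : Matrix (Fin n) (Fin n) ℝ} (hM : M ∈ unipotentUpper n)
    (hN : N ∈ unipotentUpper n) : M * N ∈ unipotentUpper n := by
  have hMu : M.IsUpperTriangular := fun i j hij => hM.2 i j hij
  have hNu : N.IsUpperTriangular := fun i j hij => hN.2 i j hij
  refine ⟨fun i => ?_, fun i j hij => hMu.mul hNu hij⟩
  rw [isUpperTriangular_mul_apply_self hMu hNu, hM.1, hN.1, one_mul]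

lemma det_submatrix_nonneg {M : Matrix (Fin n) (Fin n) ℝ} (hM : M ∈ totallyPositive n) {k : ℕ}
    {r c : Fin k → Fin n} (hr : StrictMono r) (hc : StrictMono c) :
    0 ≤ det (M.submatrix r c) := by
  rw [submatrix_eq_entry]
  exact det_nonneg hM (fun _ _ h => hr h) (fun _ _ h => hc h) fun i => (c i).isLt

lemma det_submatrix_pos {M : Matrix (Fin n) (Fin n) ℝ} (hM : M ∈ totallyPositive n) {k : ℕ}
    {r c : Fin k → Fin n} (hr : StrictMono r) (hc : StrictMono c) (h : ∀ i, r i ≤ c i) :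
    0 < det (M.submatrix r c) := by
  rw [submatrix_eq_entry]
  exact det_pos_of_le hM (fun _ _ h => hr h) (fun _ _ h => hc h) h fun i => (c i).isLt

lemma det_submatrix_mul_det_submatrix_nonneg {M N : Matrix (Fin n) (Fin n) ℝ}
    (hM : M ∈ totallyPositive n) (hN : N ∈ totallyPositive n) {k : ℕ} {r c : Fin k → Fin n}
    (hr : StrictMono r) (hc : StrictMono c) (p : Fin k → Fin n) :
    0 ≤ det (M.submatrix r p) * det (N.submatrix p c) := by
  by_cases hp : Function.Injective p
  · let σ := Tuple.sort p
    have hmono : StrictMono (p ∘ σ) :=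
      (Tuple.monotone_sort p).strictMono_of_injective (hp.comp σ.injective)
    have hcols : det (M.submatrix r (p ∘ σ)) = (Equiv.Perm.sign σ : ℤ) * det (M.submatrix r p) :=
      det_permute' σ (M.submatrix r p)
    have hrows : det (N.submatrix (p ∘ σ) c) = (Equiv.Perm.sign σ : ℤ) * det (N.submatrix p c) :=
      det_permute σ (N.submatrix p c)
    have hsign : ((Equiv.Perm.sign σ : ℤ) : ℝ) * (Equiv.Perm.sign σ : ℤ) = 1 := by
      rcases Int.units_eq_one_or (Equiv.Perm.sign σ) with h | h <;> simp [h]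
    have hsorted := mul_nonneg (det_submatrix_nonneg hM hr hmono) (det_submatrix_nonneg hN hmono hc)
    rwa [hcols, hrows, mul_mul_mul_comm, hsign, one_mul] at hsorted
  · obtain ⟨i, j, hij, hne⟩ := Function.not_injective_iff.1 hp
    rw [det_zero_of_column_eq hne fun l => by simp [hij], zero_mul]

theorem totallyPositive_mul {M N : Matrix (Fin n) (Fin n) ℝ} (hM : M ∈ totallyPositive n)
    (hN : N ∈ totallyPositive n) : M * N ∈ totallyPositive n := by
  refine mem_totallyPositive (unipotentUpper_mul hM.1 hN.1) fun k r c hr hc hle hn => ?_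
  let r' : Fin k → Fin n := fun i => ⟨r i, (hle i).trans_lt (hn i)⟩
  let c' : Fin k → Fin n := fun i => ⟨c i, hn i⟩
  have hr' : StrictMono r' := hr
  have hc' : StrictMono c' := hc
  have hsub : (of fun i j => entry (M * N) (r i) (c j))
      = M.submatrix r' id * N.submatrix id c' := by
    rw [← submatrix_mul _ _ r' id c' Function.bijective_id, submatrix_eq_entry]
  rw [hsub]
  refine pos_of_mul_pos_right ?_ (Nat.cast_nonneg (α := ℝ) (Fintype.card (Fin k)).factorial)
  rw [factorial_mul_det_mul]
  exact sum_pos' (fun p _ => det_submatrix_mul_det_submatrix_nonneg hM hN hr' hc' p)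
    ⟨r', mem_univ _, mul_pos (det_submatrix_pos hM hr' hr' fun _ => le_rfl)
      (det_submatrix_pos hN hr' hc' hle)⟩

/-- The conjugate of `M ∈ N_n` by the diagonal matrix with entries `t ^ (-i)`, written so that it
makes sense (and is the identity matrix) at `t = 0`. -/
noncomputable def scaleBy (t : ℝ) (M : Matrix (Fin n) (Fin n) ℝ) : Matrix (Fin n) (Fin n) ℝ :=
  of fun i j => t ^ ((j : ℕ) - i) * M i j

lemma scaleBy_one (M : Matrix (Fin n) (Fin n) ℝ) : scaleBy 1 M = M := by
  ext i j
  simp [scaleBy]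

lemma scaleBy_zero {M : Matrix (Fin n) (Fin n) ℝ} (hM : M ∈ unipotentUpper n) :
    scaleBy 0 M = 1 := by
  ext i j
  rw [scaleBy, of_apply]
  rcases lt_trichotomy i j with h | rfl | h
  · rw [one_apply_ne h.ne, zero_pow (Nat.sub_ne_zero_of_lt h), zero_mul]
  · rw [one_apply_eq, hM.1, Nat.sub_self, pow_zero, one_mul]
  · rw [one_apply_ne h.ne', hM.2 _ _ h, mul_zero]

lemma scaleBy_mem_unipotentUpper (t : ℝ) {M : Matrix (Fin n) (Fin n) ℝ}
    (hM : M ∈ unipotentUpper n) : scaleBy t M ∈ unipotentUpper n :=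
  ⟨fun i => by simp [scaleBy, hM.1], fun i j hij => by simp [scaleBy, hM.2 i j hij]⟩

lemma pow_mul_entry_scaleBy (t : ℝ) {M : Matrix (Fin n) (Fin n) ℝ} (hM : M ∈ unipotentUpper n)
    (i j : ℕ) : t ^ i * entry (scaleBy t M) i j = t ^ j * entry M i j := by
  rcases lt_or_ge j i with hji | hij
  · rw [entry_of_lt hM hji, entry_of_lt (scaleBy_mem_unipotentUpper t hM) hji, mul_zero, mul_zero]
  · unfold entry
    split_ifs
    · rw [scaleBy, of_apply, ← mul_assoc, ← pow_add, Nat.add_sub_cancel' hij]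
    · rw [mul_zero, mul_zero]

lemma scaleBy_mem {t : ℝ} (ht : 0 < t) {M : Matrix (Fin n) (Fin n) ℝ}
    (hM : M ∈ totallyPositive n) : scaleBy t M ∈ totallyPositive n := by
  refine mem_totallyPositive (scaleBy_mem_unipotentUpper t hM.1) fun k r c hr hc hle hn => ?_
  refine pos_of_mul_pos_right (a := ∏ i, t ^ r i) ?_ (prod_nonneg fun i _ => (pow_pos ht _).le)
  rw [← det_mul_column]
  simp only [of_apply, pow_mul_entry_scaleBy t hM.1]
  have hfactor := det_mul_row (fun j => t ^ c j) (of fun i j => entry M (r i) (c j))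
  simp only [of_apply] at hfactor
  rw [hfactor]
  exact mul_pos (prod_pos fun j _ => pow_pos ht _) (det_pos_of_le hM hr hc hle hn)

/-- A polynomial path from `M` to `N` inside `N_n^+`. -/
noncomputable def pathBetween (M N : Matrix (Fin n) (Fin n) ℝ) (t : ℝ) :
    Matrix (Fin n) (Fin n) ℝ := scaleBy (1 - t) M * scaleBy t N

lemma pathBetween_zero (M : Matrix (Fin n) (Fin n) ℝ) {N : Matrix (Fin n) (Fin n) ℝ}
    (hN : N ∈ unipotentUpper n) : pathBetween M N 0 = M := by
  rw [pathBetween, sub_zero, scaleBy_one, scaleBy_zero hN, mul_one]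

lemma pathBetween_one {M : Matrix (Fin n) (Fin n) ℝ} (hM : M ∈ unipotentUpper n)
    (N : Matrix (Fin n) (Fin n) ℝ) : pathBetween M N 1 = N := by
  rw [pathBetween, sub_self, scaleBy_one, scaleBy_zero hM, one_mul]

lemma pathBetween_mem {M N : Matrix (Fin n) (Fin n) ℝ} (hM : M ∈ totallyPositive n)
    (hN : N ∈ totallyPositive n) {t : ℝ} (ht : t ∈ Set.Icc (0 : ℝ) 1) :
    pathBetween M N t ∈ totallyPositive n := by
  rcases ht.1.eq_or_lt with rfl | h0
  · rwa [pathBetween_zero M hN.1]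
  rcases ht.2.eq_or_lt with rfl | h1
  · rwa [pathBetween_one hM.1]
  · exact totallyPositive_mul (scaleBy_mem (sub_pos.2 h1) hM) (scaleBy_mem h0 hN)

lemma differentiable_entry_pathBetween (M N : Matrix (Fin n) (Fin n) ℝ) (i j : ℕ) :
    Differentiable ℝ fun t => entry (pathBetween M N t) i j := by
  unfold entry
  split_ifs
  · simp only [pathBetween, mul_apply, scaleBy, of_apply]
    fun_prop
  · fun_prop

lemma differentiable_flagMinor_pathBetween (M N : Matrix (Fin n) (Fin n) ℝ) (I : Finset ℕ) :
    Differentiable ℝ fun t => flagMinor (pathBetween M N t) I := by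
  simp only [flagMinor, sortedMinor, dite_true, det_apply', of_apply]
  exact Differentiable.fun_sum fun σ _ => (differentiable_const _).mul <|
    Differentiable.fun_finsetProd fun i _ => differentiable_entry_pathBetween M N _ _

/-! ### The derivative of the dilogarithm -/

lemma hasDerivAt_Li2 {x : ℝ} (hx0 : 0 < x) (hx1 : x < 1) :
    HasDerivAt Li2 (-Real.log (1 - x) / x) x := by
  obtain ⟨r, hxr, hr1⟩ := exists_between hx1
  have hr0 : 0 < r := hx0.trans hxr
  have hterm (k : ℕ) (y : ℝ) :
      HasDerivAt (fun y : ℝ => y ^ (k + 1) / ((k : ℝ) + 1) ^ 2) (y ^ k / ((k : ℝ) + 1)) y := by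
    convert! (hasDerivAt_pow (k + 1) y).div_const (((k : ℝ) + 1) ^ 2) using 1
    rw [Nat.add_sub_cancel, Nat.cast_succ]
    field_simp
  have hbound (k : ℕ) (y : ℝ) (hy : y ∈ Set.Ioo (-r) r) : ‖y ^ k / ((k : ℝ) + 1)‖ ≤ r ^ k := by
    rw [norm_div, norm_pow, Real.norm_eq_abs, Real.norm_of_nonneg (by positivity : 0 ≤ (k : ℝ) + 1)]
    exact (div_le_self (by positivity) (by simp)).trans
      (pow_le_pow_left₀ (abs_nonneg _) (abs_lt.2 hy).le _)
  have hsum : ∑' k : ℕ, x ^ k / ((k : ℝ) + 1) = -Real.log (1 - x) / x := by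
    have hlog := Real.hasSum_pow_div_log_of_abs_lt_one ((abs_of_pos hx0).trans_lt hx1)
    rw [← hlog.tsum_eq, ← tsum_div_const]
    refine tsum_congr fun k => ?_
    rw [pow_succ]
    field_simp
  rw [← hsum]
  exact hasDerivAt_tsum_of_isPreconnected (summable_geometric_of_lt_one hr0.le hr1) isOpen_Ioo
    isPreconnected_Ioo (fun k y _ => hterm k y) hbound (y₀ := 0) ⟨by linarith, hr0⟩ (by simp)
    ⟨by linarith, hxr⟩

lemma hasDerivAt_rogersL {x : ℝ} (hx0 : 0 < x) (hx1 : x < 1) :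
    HasDerivAt rogersL (-(1 / 2) * (Real.log (1 - x) / x + Real.log x / (1 - x))) x := by
  have hx1' : 1 - x ≠ 0 := (sub_pos.2 hx1).ne'
  have hlog := (Real.hasDerivAt_log hx0.ne').const_mul (1 / 2)
  have hlog' := ((hasDerivAt_id x).const_sub 1).log hx1'
  convert! (hasDerivAt_Li2 hx0 hx1).add (hlog.mul hlog') using 1
  simp only [id]
  field_simp
  ring

lemma hasDerivAt_ell {x : ℝ} (hx : 0 < x) :
    HasDerivAt ell (3 / Real.pi ^ 2 * (Real.log (1 + x) / x - Real.log x / (1 + x))) x := by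
  have hx1 : 0 < 1 + x := by linarith
  have hu : HasDerivAt (fun y : ℝ => y / (1 + y)) ((1 * (1 + x) - x * 1) / (1 + x) ^ 2) x :=
    (hasDerivAt_id x).div ((hasDerivAt_id x).const_add 1) hx1.ne'
  have hL := hasDerivAt_rogersL (div_pos hx hx1) ((div_lt_one hx1).2 (by linarith))
  convert! (hL.comp x hu).const_mul (6 / Real.pi ^ 2) using 1
  have hsub : 1 - x / (1 + x) = (1 + x)⁻¹ := by field_simp; ring
  rw [hsub, Real.log_inv, Real.log_div hx.ne' hx1.ne']
  field_simp
  ring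

lemma ell_inv {x : ℝ} (hx : 0 < x) : ell x⁻¹ = 2 * ell 1 - ell x := by
  have hderiv {y : ℝ} (hy : 0 < y) : HasDerivAt (fun y => ell y + ell y⁻¹) 0 y := by
    convert! (hasDerivAt_ell hy).add
      ((hasDerivAt_ell (inv_pos.2 hy)).comp y (hasDerivAt_inv hy.ne')) using 1
    have hadd : 1 + y⁻¹ = (1 + y) / y := by field_simp; ring
    rw [hadd, Real.log_div (by positivity) hy.ne', Real.log_inv]
    field_simp
    ring
  have hconst : ell x + ell x⁻¹ = ell 1 + ell 1⁻¹ :=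
    isOpen_Ioi.is_const_of_deriv_eq_zero isPreconnected_Ioi
      (fun y hy => (hderiv hy).differentiableAt.differentiableWithinAt)
      (fun y hy => (hderiv hy).deriv) hx (Set.mem_Ioi.2 one_pos)
  rw [inv_one] at hconst
  linarith

/-- The exterior product of two logarithmic jets. -/
def wedge (u v : ℝ × ℝ) : ℝ := u.1 * v.2 - u.2 * v.1

/-- The cyclic sum of exterior products, in terms of which the dilogarithm is differentiated. -/
def tri (u v w : ℝ × ℝ) : ℝ := wedge u v + wedge v w + wedge w u

/-- The logarithmic jet of `f` at `t`: the logarithm of `f` and its derivative. -/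
noncomputable def logJet (f : ℝ → ℝ) (t : ℝ) : ℝ × ℝ := (Real.log (f t), logDeriv f t)

lemma logJet_mul {f g : ℝ → ℝ} {t : ℝ} (hf : f t ≠ 0) (hg : g t ≠ 0)
    (hdf : DifferentiableAt ℝ f t) (hdg : DifferentiableAt ℝ g t) :
    logJet (fun s => f s * g s) t = logJet f t + logJet g t :=
  Prod.ext (Real.log_mul hf hg) (logDeriv_mul t hf hg hdf hdg)

lemma hasDerivAt_ell_div {f g : ℝ → ℝ} {t : ℝ} (hf : DifferentiableAt ℝ f t)
    (hg : DifferentiableAt ℝ g t) (hf0 : 0 < f t) (hg0 : 0 < g t) :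
    HasDerivAt (fun s => ell (f s / g s))
      (3 / Real.pi ^ 2 * tri (logJet f t) (logJet g t) (logJet (fun s => f s + g s) t)) t := by
  convert! (hasDerivAt_ell (div_pos hf0 hg0)).comp t
    (hf.hasDerivAt.div hg.hasDerivAt hg0.ne') using 1
  have hadd : 1 + f t / g t = (f t + g t) / g t := by field_simp; ring
  have hfg : 0 < f t + g t := add_pos hf0 hg0
  simp only [tri, wedge, logJet, logDeriv_apply, deriv_fun_add hf hg]
  rw [hadd, Real.log_div hfg.ne' hg0.ne', Real.log_div hf0.ne' hg0.ne']
  field_simp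
  ring

/-! ### Telescoping sums over the discrete tetrahedron -/

lemma wedge_zero_left (u : ℝ × ℝ) : wedge 0 u = 0 := by simp [wedge]

lemma wedge_zero_right (u : ℝ × ℝ) : wedge u 0 = 0 := by simp [wedge]

lemma wedge_add (u v w : ℝ × ℝ) : wedge u (v + w) = wedge u v + wedge u w := by
  simp only [wedge, Prod.fst_add, Prod.snd_add]
  ring

lemma wedge_sub (u v w : ℝ × ℝ) : wedge u (v - w) = wedge u v - wedge u w := by
  simp only [wedge, Prod.fst_sub, Prod.snd_sub]
  ring

lemma wedge_self (u : ℝ × ℝ) : wedge u u = 0 := by simp only [wedge]; ring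

lemma wedge_swap (u v : ℝ × ℝ) : wedge u v = -wedge v u := by simp only [wedge]; ring

lemma tri_swap_sub (u v w g : ℝ × ℝ) : tri v u w = -tri (u - g) (v - g) (w - g) := by
  simp only [tri, wedge, Prod.fst_sub, Prod.snd_sub]
  ring

section Triangle

variable {A : Type*} [AddCommGroup A]

lemma sum_triangle_sub_right {g : ℕ → ℕ → A} {m : ℕ} (hg : ∀ i < m, g i (i + 1) = 0) :
    ∑ j ∈ range m, ∑ i ∈ range j, (g i j - g i (j + 1)) = -∑ i ∈ range m, g i m := by
  induction m with
  | zero => simp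
  | succ m ih =>
    rw [sum_range_succ, ih fun i hi => hg i (hi.trans m.lt_succ_self), sum_sub_distrib,
      sum_range_succ _ m, hg m m.lt_succ_self]
    abel

lemma sum_triangle_sub_left {g : ℕ → ℕ → A} {m : ℕ} (hg : ∀ i < m, g i i = 0) :
    ∑ j ∈ range m, ∑ i ∈ range j, (g (i + 1) j - g i j) = -∑ j ∈ range m, g 0 j := by
  rw [← sum_neg_distrib]
  refine sum_congr rfl fun j hj => ?_
  rw [sum_range_sub (fun i => g i j), hg j (mem_range.1 hj), zero_sub]

lemma sum_triangle_sub_diag {g : ℕ → ℕ → A} (hg : g 0 0 = 0) (m : ℕ) :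
    ∑ j ∈ range m, ∑ i ∈ range j, (g i j - g (i + 1) (j + 1))
      = ∑ j ∈ range (m + 1), g 0 j - ∑ i ∈ range m, g i m := by
  induction m with
  | zero => simp [hg]
  | succ m ih =>
    rw [sum_range_succ, ih, sum_sub_distrib, sum_range_succ _ (m + 1),
      sum_range_succ' (fun i => g i (m + 1)) m]
    abel

end Triangle

section Simplex

variable {A : Type*} [AddCommMonoid A]

lemma sum_triangle_reflect (F : ℕ → ℕ → A) (n : ℕ) :
    ∑ j ∈ range n, ∑ i ∈ range j, F (n - 1 - j) (n - 1 - i)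
      = ∑ j ∈ range n, ∑ i ∈ range j, F i j := by
  simp only [sum_sigma']
  refine sum_nbij' (fun x => ⟨n - 1 - x.2, n - 1 - x.1⟩) (fun x => ⟨n - 1 - x.2, n - 1 - x.1⟩)
    ?_ ?_ ?_ ?_ fun _ _ => rfl
  all_goals
    rintro ⟨j, i⟩ h
    simp only [mem_sigma, mem_range, Sigma.mk.injEq, heq_eq_eq] at h ⊢
    omega

lemma sum_simplex_reflect (F : ℕ → ℕ → ℕ → A) (n : ℕ) :
    ∑ k ∈ range n, ∑ j ∈ range k, ∑ i ∈ range j, F (n - 1 - k) (n - 1 - j) (n - 1 - i)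
      = ∑ k ∈ range n, ∑ j ∈ range k, ∑ i ∈ range j, F i j k := by
  simp only [sum_sigma']
  refine sum_nbij' (fun x => ⟨n - 1 - x.2.2, n - 1 - x.2.1, n - 1 - x.1⟩)
    (fun x => ⟨n - 1 - x.2.2, n - 1 - x.2.1, n - 1 - x.1⟩) ?_ ?_ ?_ ?_ fun _ _ => rfl
  all_goals
    rintro ⟨k, j, i⟩ h
    simp only [mem_sigma, mem_range, Sigma.mk.injEq, heq_eq_eq] at h ⊢
    omega

lemma sum_simplex_congr {F G : ℕ → ℕ → ℕ → A} {n : ℕ}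
    (h : ∀ ⦃i j k⦄, i < j → j < k → k < n → F i j k = G i j k) :
    ∑ k ∈ range n, ∑ j ∈ range k, ∑ i ∈ range j, F i j k
      = ∑ k ∈ range n, ∑ j ∈ range k, ∑ i ∈ range j, G i j k :=
  sum_congr rfl fun _ hk => sum_congr rfl fun _ hj => sum_congr rfl fun _ hi =>
    h (mem_range.1 hi) (mem_range.1 hj) (mem_range.1 hk)

end Simplex

/-- The exterior form attached to an octahedron of the discrete tetrahedron, whose pairs of opposite
vertices are the three arguments of `tri`. -/
noncomputable def octForm (h : ℕ → ℕ → ℕ → ℝ × ℝ) (i j k : ℕ) : ℝ :=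
  tri (h i j (k + 1) + h (i + 1) (j + 1) k) (h i (j + 1) (k + 1) + h (i + 1) j k)
    (h i j k + h (i + 1) (j + 1) (k + 1))

/-- The exterior form attached to a triangular face of the discrete tetrahedron. -/
noncomputable def faceForm (f : ℕ → ℕ → ℝ × ℝ) (m : ℕ) : ℝ :=
  ∑ j ∈ range m, ∑ i ∈ range j, wedge (f i j) (f i (j + 1) + f (i + 1) j - f (i + 1) (j + 1))

/-- The exterior form attached to a triangular face, with the orientation reversed. -/
noncomputable def coFaceForm (f : ℕ → ℕ → ℝ × ℝ) (m : ℕ) : ℝ :=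
  ∑ j ∈ range m, ∑ i ∈ range j, wedge (f (i + 1) (j + 1)) (f i (j + 1) + f (i + 1) j - f i j)

lemma faceForm_congr {f f' : ℕ → ℕ → ℝ × ℝ} {n : ℕ}
    (h : ∀ i j, i ≤ j → j ≤ n → f i j = f' i j) : faceForm f n = faceForm f' n := by
  refine sum_congr rfl fun j hj => sum_congr rfl fun i hi => ?_
  rw [mem_range] at hi hj
  rw [h i j (by omega) (by omega), h i (j + 1) (by omega) (by omega),
    h (i + 1) j (by omega) (by omega), h (i + 1) (j + 1) (by omega) (by omega)]

lemma faceForm_reflect (f : ℕ → ℕ → ℝ × ℝ) (n : ℕ) :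
    faceForm (fun i j => f (n - j) (n - i)) n = coFaceForm f n := by
  rw [faceForm, coFaceForm, ← sum_triangle_reflect]
  refine sum_congr rfl fun j hj => sum_congr rfl fun i hi => ?_
  rw [mem_range] at hi hj
  have hj0 : n - (n - 1 - j) = j + 1 := by omega
  have hi0 : n - (n - 1 - i) = i + 1 := by omega
  have hj1 : n - (n - 1 - j + 1) = j := by omega
  have hi1 : n - (n - 1 - i + 1) = i := by omega
  rw [hj0, hi0, hj1, hi1]

lemma faceForm_succ {f : ℕ → ℕ → ℝ × ℝ} {m : ℕ} (hdiag : ∀ i ≤ m, f i i = 0)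
    (hlast : ∀ i ≤ m + 1, f i (m + 1) = 0) :
    faceForm f (m + 1) = ∑ j ∈ range m, ∑ i ∈ range j,
      (wedge (f i j) (f i (j + 1)) + wedge (f i (j + 1)) (f (i + 1) (j + 1))
        - wedge (f i j) (f (i + 1) (j + 1))) := by
  have hlayer {F : ℕ → ℕ → ℝ} (hF : ∀ i < m, F i m = 0) :
      ∑ j ∈ range (m + 1), ∑ i ∈ range j, F i j = ∑ j ∈ range m, ∑ i ∈ range j, F i j := by
    rw [sum_range_succ, sum_eq_zero fun i hi => hF i (mem_range.1 hi), add_zero]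
  have hshift : ∑ j ∈ range (m + 1), ∑ i ∈ range j, wedge (f i j) (f (i + 1) j)
      = ∑ j ∈ range m, ∑ i ∈ range j, wedge (f i (j + 1)) (f (i + 1) (j + 1)) := by
    rw [sum_range_succ', range_zero, sum_empty, add_zero]
    refine sum_congr rfl fun j hj => ?_
    rw [sum_range_succ, hdiag (j + 1) (mem_range.1 hj), wedge_zero_right, add_zero]
  simp only [faceForm, wedge_add, wedge_sub, sum_add_distrib, sum_sub_distrib]
  rw [hshift, hlayer fun i hi => by rw [hlast i (by omega), wedge_zero_right],
    hlayer fun i hi => by rw [hlast (i + 1) (by omega), wedge_zero_right]]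

lemma octForm_eq (h : ℕ → ℕ → ℕ → ℝ × ℝ) (i j k : ℕ) :
    octForm h i j k
      = (wedge (h i j (k + 1)) (h i (j + 1) (k + 1))
          + wedge (h i (j + 1) (k + 1)) (h (i + 1) (j + 1) (k + 1))
          - wedge (h i j (k + 1)) (h (i + 1) (j + 1) (k + 1)))
        - wedge (h i j k) (h i (j + 1) k + h (i + 1) j k - h (i + 1) (j + 1) k)
        + (wedge (h (i + 1) j k) (h (i + 1) (j + 1) (k + 1) - h (i + 1) (j + 1) k)
          - wedge (h i j k) (h i (j + 1) (k + 1) - h i (j + 1) k))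
        + (wedge (h i j (k + 1)) (h (i + 1) j k)
          - wedge (h i (j + 1) (k + 1)) (h (i + 1) (j + 1) k))
        + (wedge (h i j k) (h i j (k + 1))
          - wedge (h (i + 1) (j + 1) k) (h (i + 1) (j + 1) (k + 1))) := by
  simp only [octForm, tri, wedge, Prod.fst_add, Prod.snd_add, Prod.fst_sub, Prod.snd_sub]
  ring

lemma sum_layer_octForm {h : ℕ → ℕ → ℕ → ℝ × ℝ} {m : ℕ} (hdiag : ∀ i ≤ m, ∀ k, h i i k = 0)
    (hbase : ∀ i j, i ≤ j → j ≤ m + 1 → h i j j = 0) :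
    ∑ j ∈ range m, ∑ i ∈ range j, octForm h i j m
      = faceForm (fun i j => h i j (m + 1)) (m + 1) - faceForm (fun i j => h i j m) m
        + ∑ j ∈ range m, wedge (h 0 j m)
          (h 0 j (m + 1) + h 0 (j + 1) m - h 0 (j + 1) (m + 1)) := by
  have hbase_m {i : ℕ} (hi : i ≤ m) : h i m m = 0 := hbase i m hi m.le_succ
  have hleft := sum_triangle_sub_left (m := m)
    (g := fun i j => wedge (h i j m) (h i (j + 1) (m + 1) - h i (j + 1) m))
    fun i hi => by rw [hdiag i hi.le, wedge_zero_left]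
  have hright := sum_triangle_sub_right (m := m)
    (g := fun i j => wedge (h i j (m + 1)) (h (i + 1) j m))
    fun i hi => by rw [hdiag (i + 1) hi, wedge_zero_right]
  have hright_end : ∑ i ∈ range m, wedge (h i m (m + 1)) (h (i + 1) m m) = 0 :=
    sum_eq_zero fun i hi => by rw [hbase_m (mem_range.1 hi), wedge_zero_right]
  have hmid := sum_triangle_sub_diag (g := fun i j => wedge (h i j m) (h i j (m + 1)))
    (by rw [hdiag 0 m.zero_le, wedge_zero_left]) m
  have hmid_end : ∑ i ∈ range m, wedge (h i m m) (h i m (m + 1)) = 0 :=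
    sum_eq_zero fun i hi => by rw [hbase_m (mem_range.1 hi).le, wedge_zero_left]
  rw [hright_end] at hright
  rw [hmid_end, sum_range_succ, hbase_m m.zero_le, wedge_zero_left] at hmid
  rw [faceForm_succ (f := fun i j => h i j (m + 1)) (fun i hi => hdiag i hi _)
    fun i hi => hbase i _ hi le_rfl, faceForm]
  simp only [octForm_eq, sum_add_distrib, sum_sub_distrib, wedge_add, wedge_sub]
    at hleft hright hmid ⊢
  linarith

lemma sum_octForm {h : ℕ → ℕ → ℕ → ℝ × ℝ} {n : ℕ} (hdiag : ∀ i ≤ n, ∀ k, h i i k = 0)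
    (hbase : ∀ i j, i ≤ j → j ≤ n → h i j j = 0) :
    ∑ k ∈ range n, ∑ j ∈ range k, ∑ i ∈ range j, octForm h i j k
      = faceForm (fun i j => h i j n) n + faceForm (h 0) n := by
  induction n with
  | zero => simp [faceForm]
  | succ m ih =>
    have hface : faceForm (h 0) (m + 1) = faceForm (h 0) m + ∑ j ∈ range m, wedge (h 0 j m)
        (h 0 j (m + 1) + h 0 (j + 1) m - h 0 (j + 1) (m + 1)) := sum_range_succ _ _
    rw [sum_range_succ, ih (fun i hi => hdiag i (hi.trans m.le_succ))
        (fun i j hij hj => hbase i j hij (hj.trans m.le_succ)),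
      sum_layer_octForm (fun i hi => hdiag i (hi.trans m.le_succ)) hbase, hface]
    ring

lemma faceForm_add_coFaceForm_sub {f : ℕ → ℕ → ℝ × ℝ} {c : ℕ → ℝ × ℝ} {n : ℕ}
    (hf : ∀ i ≤ n, f i i = 0) (hc : c 0 = 0) :
    faceForm f n + coFaceForm (fun i j => f i j - c (j - i)) n
      = ∑ j ∈ range n, (wedge (f 0 j) (f 0 (j + 1)) - wedge (c j) (f 0 (j + 1))
            + wedge (c j) (c (j + 1)))
        - ∑ i ∈ range n, (wedge (f i n) (f (i + 1) n) - wedge (c (n - i)) (f (i + 1) n)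
            + wedge (c (n - i)) (f i n))
        + ∑ j ∈ range (n + 1), wedge (c j) (f 0 j) := by
  let L (i j : ℕ) : ℝ := wedge (c (j - i)) (f i (j + 1)) - wedge (f i j) (f i (j + 1))
    - wedge (c (j - i)) (c (j + 1 - i))
  let R (i j : ℕ) : ℝ := wedge (f i j) (f (i + 1) j) - wedge (c (j - i)) (f (i + 1) j)
  let D (i j : ℕ) : ℝ := wedge (c (j - i)) (f i j)
  have hexpand : faceForm f n + coFaceForm (fun i j => f i j - c (j - i)) n
      = ∑ j ∈ range n, ∑ i ∈ range j, (L (i + 1) j - L i j)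
        + ∑ j ∈ range n, ∑ i ∈ range j, (R i j - R i (j + 1))
        + ∑ j ∈ range n, ∑ i ∈ range j, (D i j - D (i + 1) (j + 1)) := by
    simp only [faceForm, coFaceForm, ← sum_add_distrib]
    refine sum_congr rfl fun j _ => sum_congr rfl fun i _ => ?_
    simp only [L, R, D, Nat.add_sub_add_right, wedge, Prod.fst_add, Prod.snd_add, Prod.fst_sub,
      Prod.snd_sub]
    ring
  have hL : ∀ i < n, L i i = 0 := fun i hi => by
    simp only [L, hf i hi.le, Nat.sub_self, hc, wedge_zero_left, sub_zero]
  have hR : ∀ i < n, R i (i + 1) = 0 := fun i hi => by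
    simp only [R, hf (i + 1) hi, wedge_zero_right, sub_zero]
  have hD : D 0 0 = 0 := by simp only [D, Nat.sub_self, hc, wedge_zero_left]
  rw [hexpand, sum_triangle_sub_left hL, sum_triangle_sub_right hR, sum_triangle_sub_diag hD]
  simp only [L, R, D, Nat.sub_zero, sum_add_distrib, sum_sub_distrib]
  ring

/-- The exterior form that is the derivative of the dilogarithm of `flagRatio M S a b c`, where `l`
stands for the logarithmic jets of the flag minors. -/
noncomputable def flagForm (l : Finset ℕ → ℝ × ℝ) (S : Finset ℕ) (a b c : ℕ) : ℝ :=
  tri (l (insert a S) + l (insert b (insert c S))) (l (insert a (insert b S)) + l (insert c S))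
    (l (insert a (insert c S)) + l (insert b S))

/-- The further rows in the ratio `Y_{abc}`, where `(a, b, c) = (i + 1, j + 1, k + 1)`. -/
def lowRows (n i j k : ℕ) : Finset ℕ := Ico (i + 1) j ∪ Ico (k + 1) n

/-- The further rows in the ratio `Ỹ_{abc}`, where `(a, b, c) = (i + 1, j + 1, k + 1)`. -/
def tlowRows (i j k : ℕ) : Finset ℕ := Ico 0 i ∪ Ico (j + 1) k

lemma flagForm_low (l : Finset ℕ → ℝ × ℝ) {n i j k : ℕ} (hij : i < j) (hkn : k < n) :
    flagForm l (lowRows n i j k) i j k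
      = octForm (fun i j k => l (Ico i j ∪ Ico k n)) i j k := by
  have hi {b : ℕ} (hb : i < b) (T : Finset ℕ) :
      insert i (Ico (i + 1) b ∪ T) = Ico i b ∪ T := by
    rw [← insert_union, insert_Ico_add_one_left_eq_Ico hb]
  have hj (T : Finset ℕ) : insert j (Ico (i + 1) j ∪ T) = Ico (i + 1) (j + 1) ∪ T := by
    rw [← insert_union, insert_Ico_right_eq_Ico_add_one hij]
  have hk (T : Finset ℕ) : insert k (T ∪ Ico (k + 1) n) = T ∪ Ico k n := by
    rw [← union_insert, insert_Ico_add_one_left_eq_Ico hkn]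
  simp only [flagForm, octForm, lowRows, hi hij, hi (Nat.lt_succ_of_lt hij), hj, hk]

/-- The logarithmic jets of the reflected rows, normalized by those of the initial rows so that they
vanish on a face of the discrete tetrahedron. -/
noncomputable def reflectedJet (l : Finset ℕ → ℝ × ℝ) (n a b c : ℕ) : ℝ × ℝ :=
  l (Ico 0 (n - c) ∪ Ico (n - b) (n - a)) - l (Ico 0 (n - c + (b - a)))

lemma flagForm_tlow (l : Finset ℕ → ℝ × ℝ) {n i j k : ℕ} (hij : i < j) (hjk : j < k)
    (hkn : k < n) : flagForm l (tlowRows i j k) i j k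
      = -octForm (reflectedJet l n) (n - 1 - k) (n - 1 - j) (n - 1 - i) := by
  have hi (T : Finset ℕ) : insert i (Ico 0 i ∪ T) = Ico 0 (i + 1) ∪ T := by
    rw [← insert_union, insert_Ico_right_eq_Ico_add_one i.zero_le]
  have hj {c : ℕ} (hc : j < c) (T : Finset ℕ) : insert j (T ∪ Ico (j + 1) c) = T ∪ Ico j c := by
    rw [← union_insert, insert_Ico_add_one_left_eq_Ico hc]
  have hk (T : Finset ℕ) : insert k (T ∪ Ico (j + 1) k) = T ∪ Ico (j + 1) (k + 1) := by
    rw [← union_insert, insert_Ico_right_eq_Ico_add_one hjk]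
  have hrefl {x : ℕ} (hx : x < n) : n - (n - 1 - x) = x + 1 := by omega
  have hrefl' {x : ℕ} (hx : x < n) : n - (n - 1 - x + 1) = x := by omega
  have hwidth : n - 1 - j - (n - 1 - k) = k - j := by omega
  have hwidth' : n - 1 - j + 1 - (n - 1 - k) = k - j + 1 := by omega
  have hshort : i + 1 + (n - 1 - j - (n - 1 - k + 1)) = i + (k - j) := by omega
  have hjn := hjk.trans hkn
  simp only [flagForm, octForm, reflectedJet, tlowRows, hi, hj hjk, hj (Nat.lt_succ_of_lt hjk),
    hk, hrefl hkn, hrefl hjn, hrefl (hij.trans hjn), hrefl' hkn, hrefl' hjn, hrefl' (hij.trans hjn),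
    Nat.add_sub_add_right, hwidth, hwidth', hshort, add_right_comm i 1 (k - j), ← add_assoc i]
  rw [tri_swap_sub (g := l (Ico 0 (i + (k - j))) + l (Ico 0 (i + (k - j) + 1)))]
  congr 2 <;> abel

/-- The jets on the face `c = n` of the discrete tetrahedron. -/
def intervalJet (l : Finset ℕ → ℝ × ℝ) (i j : ℕ) : ℝ × ℝ := l (Ico i j)

/-- The jets on the face `a = 0` of the discrete tetrahedron. -/
def gapJet (l : Finset ℕ → ℝ × ℝ) (n i j : ℕ) : ℝ × ℝ := l (Ico 0 i ∪ Ico j n)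

lemma sum_flagForm_low {l : Finset ℕ → ℝ × ℝ} {n : ℕ} (hl : ∀ a, l (Ico a n) = 0) :
    ∑ k ∈ range n, ∑ j ∈ range k, ∑ i ∈ range j, flagForm l (lowRows n i j k) i j k
      = faceForm (intervalJet l) n + faceForm (gapJet l n) n := by
  have hoct := sum_octForm (h := fun i j k => l (Ico i j ∪ Ico k n)) (n := n)
    (fun i _ k => by simp only [Ico_self, empty_union, hl])
    fun i j hij hj => by simp only [Ico_union_Ico_eq_Ico hij hj, hl]
  simp only [Ico_self, union_empty] at hoct
  exact (sum_simplex_congr fun i j k hij _ hk => flagForm_low l hij hk).trans hoct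

lemma sum_flagForm_tlow (l : Finset ℕ → ℝ × ℝ) (n : ℕ) :
    ∑ k ∈ range n, ∑ j ∈ range k, ∑ i ∈ range j, flagForm l (tlowRows i j k) i j k
      = -(coFaceForm (fun i j => intervalJet l i j - l (Ico 0 (j - i))) n
        + coFaceForm (fun i j => gapJet l n i j - l (Ico 0 (n - (j - i)))) n) := by
  have hoct := sum_octForm (h := reflectedJet l n) (n := n)
    (fun i _ k => by simp only [reflectedJet, Ico_self, union_empty, Nat.sub_self, add_zero,
      sub_self])
    fun i j hij hj => by
      have hwidth : n - j + (j - i) = n - i := by omega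
      rw [reflectedJet, Ico_union_Ico_eq_Ico (Nat.zero_le _) (by omega), hwidth, sub_self]
  have hinterval : faceForm (fun i j => reflectedJet l n i j n) n
      = coFaceForm (fun i j => intervalJet l i j - l (Ico 0 (j - i))) n := by
    rw [← faceForm_reflect]
    refine faceForm_congr fun i j hij hj => ?_
    have hwidth : n - i - (n - j) = j - i := by omega
    simp only [reflectedJet, intervalJet, hwidth, Nat.sub_self, Ico_self, empty_union, zero_add]
  have hgap : faceForm (reflectedJet l n 0) n
      = coFaceForm (fun i j => gapJet l n i j - l (Ico 0 (n - (j - i)))) n := by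
    rw [← faceForm_reflect]
    refine faceForm_congr fun i j hij hj => ?_
    have hwidth : n - (n - i - (n - j)) = n - j + i := by omega
    simp only [reflectedJet, gapJet, hwidth, Nat.sub_zero]
  rw [← hinterval, ← hgap, ← hoct, ← sum_simplex_reflect (octForm (reflectedJet l n))]
  simp only [← sum_neg_distrib]
  exact sum_simplex_congr fun i j k hij hjk hk => flagForm_tlow l hij hjk hk

lemma faceForm_intervalJet {l : Finset ℕ → ℝ × ℝ} {n : ℕ} (hl : ∀ a, l (Ico a n) = 0) :
    faceForm (intervalJet l) n + coFaceForm (fun i j => intervalJet l i j - l (Ico 0 (j - i))) n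
      = ∑ j ∈ range n, wedge (l (Ico 0 j)) (l (Ico 0 (j + 1))) := by
  have hl0 : l ∅ = 0 := by simpa using hl n
  rw [faceForm_add_coFaceForm_sub (f := intervalJet l) (c := fun d => l (Ico 0 d))
    (fun i _ => by rw [intervalJet, Ico_self, hl0]) (by rw [Ico_self, hl0])]
  simp only [intervalJet, hl, wedge_self, wedge_zero_right, sub_self, zero_add, sum_const_zero,
    sub_zero, add_zero]

lemma sum_wedge_reflect (g : ℕ → ℝ × ℝ) (n : ℕ) :
    ∑ j ∈ range n, wedge (g (n - j)) (g (n - (j + 1)))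
      = -∑ j ∈ range n, wedge (g j) (g (j + 1)) := by
  rw [← sum_range_reflect, ← sum_neg_distrib]
  refine sum_congr rfl fun j hj => ?_
  rw [mem_range] at hj
  have hj0 : n - (n - 1 - j) = j + 1 := by omega
  have hj1 : n - (n - 1 - j + 1) = j := by omega
  rw [hj0, hj1, wedge_swap]

lemma faceForm_gapJet {l : Finset ℕ → ℝ × ℝ} {n : ℕ} (hl : ∀ a, l (Ico a n) = 0) :
    faceForm (gapJet l n) n + coFaceForm (fun i j => gapJet l n i j - l (Ico 0 (n - (j - i)))) n
      = -∑ j ∈ range n, wedge (l (Ico 0 j)) (l (Ico 0 (j + 1))) := by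
  rw [faceForm_add_coFaceForm_sub (f := gapJet l n) (c := fun d => l (Ico 0 (n - d)))
    (fun i hi => by rw [gapJet, Ico_union_Ico_eq_Ico i.zero_le hi, hl]) (hl 0)]
  have hlast : ∑ i ∈ range n, (wedge (l (Ico 0 i)) (l (Ico 0 (i + 1)))
      - wedge (l (Ico 0 (n - (n - i)))) (l (Ico 0 (i + 1)))
      + wedge (l (Ico 0 (n - (n - i)))) (l (Ico 0 i))) = 0 :=
    sum_eq_zero fun i hi => by
      rw [Nat.sub_sub_self (mem_range.1 hi).le, sub_self, zero_add, wedge_self]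
  simp only [gapJet, Ico_self, empty_union, union_empty, hl, wedge_zero_right, sub_self, zero_add,
    sum_const_zero, add_zero, hlast, sub_zero]
  exact sum_wedge_reflect (fun j => l (Ico 0 j)) n

theorem sum_flagForm_low_eq_tlow {l : Finset ℕ → ℝ × ℝ} {n : ℕ} (hl : ∀ a, l (Ico a n) = 0) :
    ∑ k ∈ range n, ∑ j ∈ range k, ∑ i ∈ range j, flagForm l (lowRows n i j k) i j k
      = ∑ k ∈ range n, ∑ j ∈ range k, ∑ i ∈ range j, flagForm l (tlowRows i j k) i j k := by
  rw [sum_flagForm_low hl, sum_flagForm_tlow]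
  linarith [faceForm_intervalJet hl, faceForm_gapJet hl]

/-! ### Equality of the two sums over right flag minors -/

/-- A choice, for all `i < j < k < n`, of a set of further rows: the flag minors on these rows and
one or two of `i`, `j`, `k` enter a flag ratio. -/
def IsRowSystem (n : ℕ) (R : ℕ → ℕ → ℕ → Finset ℕ) : Prop :=
  ∀ ⦃i j k⦄, i < j → j < k → k < n →
    R i j k ⊆ range n ∧ i ∉ R i j k ∧ j ∉ R i j k ∧ k ∉ R i j k

/-- The dilogarithm sum over the flag ratios of a row system. -/
noncomputable def ellSum (R : ℕ → ℕ → ℕ → Finset ℕ) (M : Matrix (Fin n) (Fin n) ℝ) : ℝ :=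
  ∑ k ∈ range n, ∑ j ∈ range k, ∑ i ∈ range j, ell (flagRatio M (R i j k) i j k)

lemma isRowSystem_lowRows (n : ℕ) : IsRowSystem n (lowRows n) := by
  intro i j k hij hjk hk
  refine ⟨fun x hx => ?_, ?_, ?_, ?_⟩ <;>
    simp only [lowRows, mem_union, mem_Ico, mem_range] at * <;> omega

lemma isRowSystem_tlowRows (n : ℕ) : IsRowSystem n tlowRows := by
  intro i j k hij hjk hk
  refine ⟨fun x hx => ?_, ?_, ?_, ?_⟩ <;>
    simp only [tlowRows, mem_union, mem_Ico, mem_range] at * <;> omega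

lemma flagMinor_Ico {M : Matrix (Fin n) (Fin n) ℝ} (hM : M ∈ unipotentUpper n) (a : ℕ) :
    flagMinor M (Ico a n) = 1 := by
  suffices h : ∀ d ≤ n, flagMinor M (Ico d n) = 1 by
    rcases le_total a n with ha | ha
    · exact h a ha
    · simpa only [Ico_eq_empty_of_le ha, Ico_self] using h n le_rfl
  intro d hd
  have h := flagMinor_image_union_Ico hM (m := 0) (r := fun _ => 0) (d := d)
    (Subsingleton.strictMono _) (fun i => i.elim0) hd
  rwa [univ_eq_empty, image_empty, empty_union, det_isEmpty] at h

lemma pathBetween_mem_unipotentUpper {M N : Matrix (Fin n) (Fin n) ℝ} (hM : M ∈ unipotentUpper n)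
    (hN : N ∈ unipotentUpper n) (t : ℝ) : pathBetween M N t ∈ unipotentUpper n :=
  unipotentUpper_mul (scaleBy_mem_unipotentUpper _ hM) (scaleBy_mem_unipotentUpper _ hN)

/-- The logarithmic jets of the flag minors along a path. -/
noncomputable def pathJet (M N : Matrix (Fin n) (Fin n) ℝ) (t : ℝ) (I : Finset ℕ) : ℝ × ℝ :=
  logJet (fun s => flagMinor (pathBetween M N s) I) t

lemma pathJet_Ico {M N : Matrix (Fin n) (Fin n) ℝ} (hM : M ∈ unipotentUpper n)
    (hN : N ∈ unipotentUpper n) (t : ℝ) (a : ℕ) : pathJet M N t (Ico a n) = 0 := by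
  have h : (fun s => flagMinor (pathBetween M N s) (Ico a n)) = fun _ => 1 :=
    funext fun s => flagMinor_Ico (pathBetween_mem_unipotentUpper hM hN s) a
  rw [pathJet, h, logJet, Real.log_one, logDeriv_const]
  rfl

lemma hasDerivAt_ell_flagRatio {M N : Matrix (Fin n) (Fin n) ℝ} (hM : M ∈ totallyPositive n)
    (hN : N ∈ totallyPositive n) {t : ℝ} (ht : t ∈ Set.Icc (0 : ℝ) 1) {S : Finset ℕ}
    (hS : S ⊆ range n) {a b c : ℕ} (ha : a ∉ S) (hb : b ∉ S) (hc : c ∉ S) (hab : a < b)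
    (hbc : b < c) (hcn : c < n) :
    HasDerivAt (fun s => ell (flagRatio (pathBetween M N s) S a b c))
      (3 / Real.pi ^ 2 * flagForm (pathJet M N t) S a b c) t := by
  have hbn : b < n := hbc.trans hcn
  have hsub {x : ℕ} (hx : x < n) {T : Finset ℕ} (hT : T ⊆ range n) : insert x T ⊆ range n :=
    insert_subset (mem_range.2 hx) hT
  have hcard : #S + 2 ≤ n := by
    rw [← card_insert_insert ha hb hab.ne, ← card_range n]
    exact card_le_card (hsub (hab.trans hbn) (hsub hbn hS))
  have hpos {I : Finset ℕ} (hI : I ⊆ range n) : 0 < flagMinor (pathBetween M N t) I :=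
    flagMinor_pos (pathBetween_mem hM hN ht) hI
  have hd (I : Finset ℕ) : DifferentiableAt ℝ (fun s => flagMinor (pathBetween M N s) I) t :=
    differentiable_flagMinor_pathBetween M N I t
  have pa := hpos (hsub (hab.trans hbn) hS)
  have pb := hpos (hsub hbn hS)
  have pc := hpos (hsub hcn hS)
  have pab := hpos (hsub (hab.trans hbn) (hsub hbn hS))
  have pac := hpos (hsub (hab.trans hbn) (hsub hcn hS))
  have pbc := hpos (hsub hbn (hsub hcn hS))
  have h := hasDerivAt_ell_div ((hd (insert a S)).fun_mul (hd (insert b (insert c S))))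
    ((hd (insert a (insert b S))).fun_mul (hd (insert c S))) (mul_pos pa pbc) (mul_pos pab pc)
  simp only [flagMinor_plucker _ hcard ha hb hc hab hbc] at h
  rwa [logJet_mul pa.ne' pbc.ne' (hd _) (hd _), logJet_mul pab.ne' pc.ne' (hd _) (hd _),
    logJet_mul pac.ne' pb.ne' (hd _) (hd _)] at h

lemma hasDerivAt_ellSum {R : ℕ → ℕ → ℕ → Finset ℕ} (hR : IsRowSystem n R)
    {M N : Matrix (Fin n) (Fin n) ℝ} (hM : M ∈ totallyPositive n) (hN : N ∈ totallyPositive n)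
    {t : ℝ} (ht : t ∈ Set.Icc (0 : ℝ) 1) :
    HasDerivAt (fun s => ellSum R (pathBetween M N s))
      (3 / Real.pi ^ 2 * ∑ k ∈ range n, ∑ j ∈ range k, ∑ i ∈ range j,
        flagForm (pathJet M N t) (R i j k) i j k) t := by
  simp only [mul_sum]
  refine HasDerivAt.fun_sum fun k hk => HasDerivAt.fun_sum fun j hj =>
    HasDerivAt.fun_sum fun i hi => ?_
  have hi := mem_range.1 hi
  have hj := mem_range.1 hj
  have hk := mem_range.1 hk
  obtain ⟨hsub, hi', hj', hk'⟩ := hR hi hj hk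
  exact hasDerivAt_ell_flagRatio hM hN ht hsub hi' hj' hk' hi hj hk

lemma ellSum_binomMatrix {R : ℕ → ℕ → ℕ → Finset ℕ} (hR : IsRowSystem n R) :
    ellSum R (binomMatrix n)
      = ∑ k ∈ range n, ∑ j ∈ range k, ∑ i ∈ range j, ell ((k - j : ℝ) / (j - i)) :=
  sum_simplex_congr fun i j k hij hjk hk => by
    obtain ⟨hsub, hi, hj, hk'⟩ := hR hij hjk hk
    rw [flagRatio_binomMatrix hsub hi hj hk' hij hjk hk]

theorem ellSum_lowRows_eq_tlowRows {M : Matrix (Fin n) (Fin n) ℝ} (hM : M ∈ totallyPositive n) :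
    ellSum (lowRows n) M = ellSum tlowRows M := by
  have hN : binomMatrix n ∈ totallyPositive n := binomMatrix_mem
  have hderiv : ∀ t ∈ Set.Icc (0 : ℝ) 1, HasDerivAt
      (fun s => ellSum (lowRows n) (pathBetween M (binomMatrix n) s)
        - ellSum tlowRows (pathBetween M (binomMatrix n) s)) 0 t := fun t ht => by
    have h := (hasDerivAt_ellSum (isRowSystem_lowRows n) hM hN ht).fun_sub
      (hasDerivAt_ellSum (isRowSystem_tlowRows n) hM hN ht)
    rwa [sum_flagForm_low_eq_tlow (pathJet_Ico hM.1 hN.1 t), sub_self] at h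
  have hconst := constant_of_has_deriv_right_zero (a := (0 : ℝ)) (b := 1)
    (fun t ht => (hderiv t ht).continuousAt.continuousWithinAt)
    (fun t ht => (hderiv t (Set.Ico_subset_Icc_self ht)).hasDerivWithinAt) 1
    (Set.right_mem_Icc.2 zero_le_one)
  rw [pathBetween_zero M hN.1, pathBetween_one hM.1, ellSum_binomMatrix (isRowSystem_lowRows n),
    ellSum_binomMatrix (isRowSystem_tlowRows n), sub_self] at hconst
  exact sub_eq_zero.1 hconst.symm

/-! ### The four families as flag ratios -/

lemma image_labels (n : ℕ) (S : Finset ℕ) :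
    univ.image (fun i => ((labels n S).orderEmbOfFin rfl i : ℕ)) = {x ∈ range n | x + 1 ∈ S} := by
  ext x
  have hrange (y : Fin n) : (∃ i, (labels n S).orderEmbOfFin rfl i = y) ↔ (y : ℕ) + 1 ∈ S := by
    rw [← Set.mem_range, range_orderEmbOfFin, mem_coe, labels, mem_filter_univ]
  simp only [mem_image, mem_univ, true_and, mem_filter, mem_range]
  constructor
  · rintro ⟨i, rfl⟩
    exact ⟨Fin.isLt _, (hrange _).1 ⟨i, rfl⟩⟩
  · rintro ⟨hx, hS⟩
    obtain ⟨i, hi⟩ := (hrange ⟨x, hx⟩).2 hS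
    exact ⟨i, by rw [hi]⟩

lemma strictMono_labels (n : ℕ) (S : Finset ℕ) :
    StrictMono fun i => ((labels n S).orderEmbOfFin rfl i : ℕ) :=
  ((labels n S).orderEmbOfFin rfl).strictMono

lemma rightMinor_eq_flagMinor (M : Matrix (Fin n) (Fin n) ℝ) (S : Finset ℕ) :
    rightMinor M S = flagMinor M {x ∈ range n | x + 1 ∈ S} := by
  rw [← image_labels, flagMinor_image M (strictMono_labels n S), rightMinor, submatrix_eq_entry]
  rfl

/-- The transpose of `M` along the antidiagonal, which exchanges right and upper flag minors. -/
def antiT (M : Matrix (Fin n) (Fin n) ℝ) : Matrix (Fin n) (Fin n) ℝ :=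
  of fun i j => M j.rev i.rev

lemma antiT_antiT (M : Matrix (Fin n) (Fin n) ℝ) : antiT (antiT M) = M := by
  ext i j
  simp [antiT]

lemma antiT_mem_unipotentUpper {M : Matrix (Fin n) (Fin n) ℝ} (hM : M ∈ unipotentUpper n) :
    antiT M ∈ unipotentUpper n :=
  ⟨fun i => by simp [antiT, hM.1], fun _ _ hij => hM.2 _ _ (Fin.rev_lt_rev.2 hij)⟩

lemma entry_antiT (M : Matrix (Fin n) (Fin n) ℝ) {i j : ℕ} (hi : i < n) (hj : j < n) :
    entry (antiT M) i j = entry M (n - 1 - j) (n - 1 - i) := by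
  rw [entry, dif_pos ⟨hi, hj⟩, entry, dif_pos (by omega), antiT, of_apply]
  congr 1 <;> ext <;> simp only [Fin.val_rev] <;> omega

lemma det_entry_antiT (M : Matrix (Fin n) (Fin n) ℝ) {k : ℕ} {r c r' c' : Fin k → ℕ}
    (hr : ∀ i, r i + c' i.rev + 1 = n) (hc : ∀ i, c i + r' i.rev + 1 = n) :
    det (of fun i j => entry (antiT M) (r i) (c j))
      = det (of fun i j => entry M (r' i) (c' j)) := by
  rw [← det_transpose, ← det_submatrix_equiv_self Fin.revPerm]
  congr 1
  ext i j
  have hrj := hr j.rev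
  have hci := hc i.rev
  rw [Fin.rev_rev] at hrj hci
  simp only [submatrix_apply, transpose_apply, of_apply, Fin.revPerm_apply]
  rw [entry_antiT M (by omega) (by omega)]
  congr 1 <;> omega

lemma strictMono_reflect {k : ℕ} {f : Fin k → ℕ} (hf : StrictMono f) (hn : ∀ i, f i < n) :
    StrictMono fun i : Fin k => n - 1 - f i.rev := fun i j hij => by
  have := hf (Fin.rev_lt_rev.2 hij)
  have := hn i.rev
  dsimp only
  omega

lemma antiT_mem {M : Matrix (Fin n) (Fin n) ℝ} (hM : M ∈ totallyPositive n) :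
    antiT M ∈ totallyPositive n := by
  refine mem_totallyPositive (antiT_mem_unipotentUpper hM.1) fun k r c hr hc hle hn => ?_
  have hrn (i : Fin k) : r i < n := (hle i).trans_lt (hn i)
  rw [det_entry_antiT M (r' := fun i => n - 1 - c i.rev) (c' := fun i => n - 1 - r i.rev)
    (fun i => by have := hrn i; simp only [Fin.rev_rev]; omega)
    fun i => by have := hn i; simp only [Fin.rev_rev]; omega]
  refine det_pos_of_le hM (strictMono_reflect hc hn) (strictMono_reflect hr hrn)
    (fun i => Nat.sub_le_sub_left (hle i.rev) _) fun i => ?_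
  have := hrn i
  omega

/-- The image of a set of labels `0, …, n - 1` under the order reversal of the labels. -/
def reflectSet (n : ℕ) (I : Finset ℕ) : Finset ℕ := I.image fun x => n - 1 - x

lemma mem_reflectSet {I : Finset ℕ} (hI : I ⊆ range n) {x : ℕ} :
    x ∈ reflectSet n I ↔ x < n ∧ n - 1 - x ∈ I := by
  rw [reflectSet, mem_image]
  constructor
  · rintro ⟨y, hy, rfl⟩
    have hyn := mem_range.1 (hI hy)
    exact ⟨by omega, by rwa [Nat.sub_sub_self (by omega)]⟩
  · rintro ⟨hx, hI⟩
    exact ⟨_, hI, by omega⟩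

lemma reflectSet_image (n : ℕ) {k : ℕ} (f : Fin k → ℕ) :
    reflectSet n (univ.image f) = univ.image fun i : Fin k => n - 1 - f i.rev := by
  ext x
  simp only [reflectSet, image_image, mem_image, mem_univ, true_and, Function.comp_apply]
  exact Fin.revPerm.exists_congr_left

lemma flagMinor_antiT_reflectSet (M : Matrix (Fin n) (Fin n) ℝ) {k : ℕ} {f : Fin k → ℕ}
    (hf : StrictMono f) (hn : ∀ i, f i < n) :
    flagMinor (antiT M) (reflectSet n (univ.image f))
      = det (of fun i j : Fin k => entry M i (f j)) := by
  have hk := card_le_of_strictMono hf hn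
  rw [reflectSet_image, flagMinor_image _ (strictMono_reflect hf hn)]
  refine det_entry_antiT M (fun i => ?_) fun i => ?_
  · have := hn i.rev
    omega
  · simp only [Fin.val_rev]
    omega

lemma upperMinor_eq_flagMinor (M : Matrix (Fin n) (Fin n) ℝ) (S : Finset ℕ) :
    upperMinor M S = flagMinor (antiT M) {x ∈ range n | n - x ∈ S} := by
  have hreflect : reflectSet n {x ∈ range n | x + 1 ∈ S} = {x ∈ range n | n - x ∈ S} := by
    ext x
    rw [mem_reflectSet (filter_subset _ _)]
    simp only [mem_filter, mem_range]
    refine and_congr_right fun hx => ?_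
    have hsub : n - 1 - x + 1 = n - x := by omega
    rw [hsub, and_iff_right (by omega)]
  rw [← hreflect, ← image_labels,
    flagMinor_antiT_reflectSet M (strictMono_labels n S) fun i => Fin.isLt _, upperMinor,
    submatrix_eq_entry]
  rfl

lemma Ylow_eq (M : Matrix (Fin n) (Fin n) ℝ) {i j k : ℕ} (hij : i < j) (hjk : j < k) (hk : k < n) :
    Ylow M (i + 1) (j + 1) (k + 1) = flagRatio M (lowRows n i j k) i j k := by
  simp only [Ylow, flagRatio, rightMinor_eq_flagMinor]
  congr 3
  all_goals
    ext x
    simp only [lowRows, mem_filter, mem_range, mem_insert, mem_union, mem_Ico, mem_Icc]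
    omega

lemma Ytlow_eq (M : Matrix (Fin n) (Fin n) ℝ) {i j k : ℕ} (hij : i < j) (hjk : j < k)
    (hk : k < n) : Ytlow M (i + 1) (j + 1) (k + 1) = flagRatio M (tlowRows i j k) i j k := by
  simp only [Ytlow, flagRatio, rightMinor_eq_flagMinor]
  congr 3
  all_goals
    ext x
    simp only [tlowRows, mem_filter, mem_range, mem_insert, mem_union, mem_Ico, mem_Icc]
    omega

lemma Ytup_eq (M : Matrix (Fin n) (Fin n) ℝ) {i j k : ℕ} (hij : i < j) (hjk : j < k)
    (hk : k < n) :
    Ytup M (n - k) (n - j) (n - i) = flagRatio (antiT M) (lowRows n i j k) i j k := by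
  rw [Ytup, flagRatio, mul_comm (upperMinor _ _), mul_comm (flagMinor _ (insert i (insert j _)))]
  simp only [upperMinor_eq_flagMinor]
  congr 3
  all_goals
    ext x
    simp only [lowRows, mem_filter, mem_range, mem_insert, mem_union, mem_Ico, mem_Icc]
    omega

lemma Yup_eq (M : Matrix (Fin n) (Fin n) ℝ) {i j k : ℕ} (hij : i < j) (hjk : j < k) (hk : k < n) :
    Yup M (n - k) (n - j) (n - i) = flagRatio (antiT M) (tlowRows i j k) i j k := by
  rw [Yup, flagRatio, mul_comm (upperMinor _ _), mul_comm (flagMinor _ (insert i (insert j _)))]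
  simp only [upperMinor_eq_flagMinor]
  congr 3
  all_goals
    ext x
    simp only [tlowRows, mem_filter, mem_range, mem_insert, mem_union, mem_Ico, mem_Icc]
    omega

lemma flagRatio_pos {M : Matrix (Fin n) (Fin n) ℝ} (hM : M ∈ totallyPositive n) {S : Finset ℕ}
    (hS : S ⊆ range n) {a b c : ℕ} (ha : a < n) (hb : b < n) (hc : c < n) :
    0 < flagRatio M S a b c := by
  have hsub {x : ℕ} (hx : x < n) {T : Finset ℕ} (hT : T ⊆ range n) : insert x T ⊆ range n :=
    insert_subset (mem_range.2 hx) hT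
  have hpos {I : Finset ℕ} (hI : I ⊆ range n) := flagMinor_pos hM hI
  exact div_pos (mul_pos (hpos (hsub ha hS)) (hpos (hsub hb (hsub hc hS))))
    (mul_pos (hpos (hsub ha (hsub hb hS))) (hpos (hsub hc hS)))

/-! ### Invariance of the sum under the antitransposition -/

/-- The minor of size `m` with consecutive rows from `a` on and consecutive columns from `d` on. -/
noncomputable def solidMinor (M : Matrix (Fin n) (Fin n) ℝ) (a d m : ℕ) : ℝ :=
  det (of fun i j : Fin m => entry M (a + i) (d + j))

lemma flagMinor_eq_solidMinor {M : Matrix (Fin n) (Fin n) ℝ} (hM : M ∈ unipotentUpper n)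
    {a d m : ℕ} (had : a ≤ d) (h : d + m ≤ n) :
    flagMinor M (Ico a (a + m) ∪ Ico (d + m) n) = solidMinor M a d m := by
  rw [← image_add_val, flagMinor_image_union_Ico hM (strictMono_add_val a m) (fun i => by omega) h]
  rfl

lemma solidMinor_antiT (M : Matrix (Fin n) (Fin n) ℝ) {a d m a' d' : ℕ} (ha : a + d' + m = n)
    (hd : d + a' + m = n) : solidMinor (antiT M) a d m = solidMinor M a' d' m := by
  refine det_entry_antiT M (fun i => ?_) fun i => ?_ <;>
  · simp only [Fin.val_rev]
    omega

lemma flagRatio_lowRows {M : Matrix (Fin n) (Fin n) ℝ} (hM : M ∈ unipotentUpper n) {i m d : ℕ}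
    (hid : i < d) (hd : d + m + 1 < n) :
    flagRatio M (lowRows n i (i + m + 1) (d + m + 1)) i (i + m + 1) (d + m + 1)
      = (solidMinor M i (d + 1) (m + 1) * solidMinor M (i + 1) d (m + 1)) /
        (solidMinor M i d (m + 2) * solidMinor M (i + 1) (d + 1) m) := by
  rw [flagRatio, ← flagMinor_eq_solidMinor hM (by omega) (by omega),
    ← flagMinor_eq_solidMinor hM (by omega) (by omega),
    ← flagMinor_eq_solidMinor hM (by omega) (by omega),
    ← flagMinor_eq_solidMinor hM (by omega) (by omega)]
  congr 3
  all_goals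
    ext x
    simp only [lowRows, mem_insert, mem_union, mem_Ico]
    omega

lemma flagRatio_lowRows_antiT {M : Matrix (Fin n) (Fin n) ℝ} (hM : M ∈ unipotentUpper n)
    {i j k : ℕ} (hij : i < j) (hjk : j < k) (hk : k < n) :
    flagRatio (antiT M) (lowRows n i j k) i j k
      = flagRatio M (lowRows n (n - 1 - k) (n - 1 - k + (j - i)) (n - 1 - i))
        (n - 1 - k) (n - 1 - k + (j - i)) (n - 1 - i) := by
  obtain ⟨m, rfl⟩ : ∃ m, j = i + m + 1 := ⟨j - i - 1, by omega⟩
  obtain ⟨d, rfl⟩ : ∃ d, k = d + m + 1 := ⟨k - m - 1, by omega⟩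
  have hmid : n - 1 - (d + m + 1) + (i + m + 1 - i) = n - 1 - (d + m + 1) + m + 1 := by omega
  have hlast : n - 1 - i = n - 1 - (i + m + 1) + m + 1 := by omega
  rw [hmid, hlast, flagRatio_lowRows (antiT_mem_unipotentUpper hM) (by omega) hk,
    flagRatio_lowRows hM (by omega) (by omega)]
  congr 2 <;> refine solidMinor_antiT M ?_ ?_ <;> omega

theorem ellSum_lowRows_antiT {M : Matrix (Fin n) (Fin n) ℝ} (hM : M ∈ unipotentUpper n) :
    ellSum (lowRows n) (antiT M) = ellSum (lowRows n) M := by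
  simp only [ellSum, sum_sigma']
  refine sum_nbij' (fun x => ⟨n - 1 - x.2.2, n - 1 - x.1 + (x.2.1 - x.2.2), n - 1 - x.1⟩)
    (fun x => ⟨n - 1 - x.2.2, n - 1 - x.1 + (x.2.1 - x.2.2), n - 1 - x.1⟩) ?_ ?_ ?_ ?_ ?_
  on_goal 5 =>
    rintro ⟨k, j, i⟩ h
    simp only [mem_sigma, mem_range] at h
    rw [flagRatio_lowRows_antiT hM h.2.2 h.2.1 h.1]
  all_goals
    rintro ⟨k, j, i⟩ h
    simp only [mem_sigma, mem_range, Sigma.mk.injEq, heq_eq_eq] at h ⊢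
    omega

lemma sum_tetra {A : Type*} [AddCommMonoid A] (F : ℕ → ℕ → ℕ → A) (n : ℕ) :
    ∑ t ∈ tetra n, F t.1 t.2.1 t.2.2
      = ∑ k ∈ range n, ∑ j ∈ range k, ∑ i ∈ range j, F (i + 1) (j + 1) (k + 1) := by
  simp only [sum_sigma']
  symm
  refine sum_nbij' (fun x => (x.2.2 + 1, x.2.1 + 1, x.1 + 1))
    (fun x => ⟨x.2.2 - 1, x.2.1 - 1, x.1 - 1⟩) ?_ ?_ (fun _ _ => rfl) ?_ fun _ _ => rfl
  · rintro ⟨k, j, i⟩ h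
    simp only [tetra, mem_filter, mem_product, mem_Icc, mem_sigma, mem_range] at h ⊢
    omega
  all_goals
    rintro ⟨a, b, c⟩ h
    simp only [tetra, mem_filter, mem_product, mem_Icc, mem_sigma, mem_range, Prod.mk.injEq] at h ⊢
    omega

lemma sum_tetra_reverse {A : Type*} [AddCommMonoid A] (F : ℕ → ℕ → ℕ → A) (n : ℕ) :
    ∑ t ∈ tetra n, F t.1 t.2.1 t.2.2
      = ∑ k ∈ range n, ∑ j ∈ range k, ∑ i ∈ range j, F (n - k) (n - j) (n - i) := by
  rw [sum_tetra, ← sum_simplex_reflect]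
  refine sum_simplex_congr fun i j k hij hjk hk => ?_
  congr 1 <;> omega

/-! ### The triangular factorization -/

section Triangular

variable {ι K : Type*} [Fintype ι] [LinearOrder ι] [Field K]

lemma exists_row_combination (X : Matrix ι ι K) {i : ι}
    (h : (X.toSquareBlockProp (· < i)).det ≠ 0) :
    ∃ w : ι → K, w i = 1 ∧ (∀ j, i < j → w j = 0) ∧ ∀ j < i, (w ᵥ* X) j = 0 := by
  let S := X.toSquareBlockProp (· < i)
  let v : {j // j < i} → K := (fun j : {j // j < i} => -X i j) ᵥ* S⁻¹
  let w : ι → K := fun j => if hj : j < i then v ⟨j, hj⟩ else if j = i then 1 else 0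
  have hwi : w i = 1 := by simp [w]
  have hw (j : {j // ¬j < i}) (hj : j ≠ ⟨i, lt_irrefl i⟩) : w j = 0 := by
    rw [Ne, Subtype.ext_iff] at hj
    simp [w, j.2, hj]
  refine ⟨w, hwi, fun j hj => hw ⟨j, hj.le.not_gt⟩ fun he => hj.ne' congr($he), fun j hj => ?_⟩
  have hv : (v ᵥ* S) ⟨j, hj⟩ = -X i j := by
    rw [vecMul_vecMul, nonsing_inv_mul _ h.isUnit, vecMul_one]
  rw [vecMul, dotProduct, ← Fintype.sum_subtype_add_sum_subtype (· < i),
    Fintype.sum_eq_single (⟨i, lt_irrefl i⟩ : {j // ¬j < i}) fun l hl => by rw [hw l hl, zero_mul],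
    hwi, one_mul, ← eq_neg_iff_add_eq_zero, ← hv]
  exact sum_congr rfl fun l _ => by rw [show w l = v l from dif_pos l.2]; rfl

lemma exists_isLowerTriangular_mul (X : Matrix ι ι K)
    (h : ∀ i, (X.toSquareBlockProp (· < i)).det ≠ 0) :
    ∃ L : Matrix ι ι K, (∀ i, L i i = 1) ∧ L.IsLowerTriangular ∧ (L * X).IsUpperTriangular := by
  choose w hw1 hw0 hwX using fun i => exists_row_combination X (h i)
  refine ⟨of w, hw1, fun i j hij => hw0 i j hij, fun i j hij => ?_⟩
  exact (mul_apply_eq_vecMul (of w) X i ▸ hwX i j hij :)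

theorem exists_mul_mul_eq_diagonal (X : Matrix ι ι K)
    (h : ∀ i, (X.toSquareBlockProp (· < i)).det ≠ 0) :
    ∃ (L U : Matrix ι ι K) (d : ι → K), ((∀ i, L i i = 1) ∧ L.IsLowerTriangular) ∧
      ((∀ i, U i i = 1) ∧ U.IsUpperTriangular) ∧ L * X * U = diagonal d := by
  obtain ⟨L, hL1, hL, hLX⟩ := exists_isLowerTriangular_mul X h
  obtain ⟨V, hV1, hV, hVX⟩ := exists_isLowerTriangular_mul Xᵀ fun i => by
    rw [← det_transpose]
    exact h i
  have hU : Vᵀ.IsUpperTriangular := fun i j hij => hV hij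
  have hXU : (X * Vᵀ).IsLowerTriangular := fun i j hij => by
    rw [← transpose_apply (X * Vᵀ), transpose_mul, transpose_transpose]
    exact hVX hij
  have hdiag : (L * X * Vᵀ).IsDiag := fun i j hij => by
    rcases hij.lt_or_gt with hij | hij
    · rw [Matrix.mul_assoc]
      exact hL.mul hXU hij
    · exact hLX.mul hU hij
  exact ⟨L, Vᵀ, _, ⟨hL1, hL⟩, ⟨hV1, hU⟩, hdiag.diagonal_diag.symm⟩

end Triangular

lemma isUnit_of_mem_unipotentUpper {A : Matrix (Fin n) (Fin n) ℝ} (hA : A ∈ unipotentUpper n) :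
    IsUnit A := by
  rw [isUnit_iff_isUnit_det, det_of_isUpperTriangular (fun i j hij => hA.2 i j hij),
    prod_eq_one fun i _ => hA.1 i]
  exact isUnit_one

lemma unipotentUpper_inv {A : Matrix (Fin n) (Fin n) ℝ} (hA : A ∈ unipotentUpper n) :
    A⁻¹ ∈ unipotentUpper n := by
  have hunit := isUnit_of_mem_unipotentUpper hA
  have := hunit.invertible
  have hinv : A⁻¹.IsUpperTriangular :=
    blockTriangular_inv_of_blockTriangular fun i j hij => hA.2 i j hij
  refine ⟨fun i => ?_, fun i j hij => hinv hij⟩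
  have hdiag := isUpperTriangular_mul_apply_self (fun i j hij => hA.2 i j hij) hinv i
  rwa [mul_nonsing_inv _ ((isUnit_iff_isUnit_det A).1 hunit), one_apply_eq, hA.1, one_mul,
    eq_comm] at hdiag

lemma revMatrix_apply (i j : Fin n) : revMatrix n i j = if j = i.rev then 1 else 0 := by
  rw [revMatrix, of_apply]
  congr 1
  rw [eq_iff_iff, Fin.ext_iff, Fin.val_rev]
  omega

lemma revMatrix_mul (M : Matrix (Fin n) (Fin n) ℝ) (i j : Fin n) :
    (revMatrix n * M) i j = M i.rev j := by
  simp [mul_apply, revMatrix_apply]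

lemma mul_revMatrix (M : Matrix (Fin n) (Fin n) ℝ) (i j : Fin n) :
    (M * revMatrix n) i j = M i j.rev := by
  simp [mul_apply, revMatrix_apply, ← Fin.rev_eq_iff]

lemma revMatrix_mul_revMatrix (n : ℕ) : revMatrix n * revMatrix n = 1 := by
  ext i j
  rw [revMatrix_mul, revMatrix_apply, Fin.rev_rev, one_apply]
  simp only [eq_comm]

lemma revMatrix_mul_mul_revMatrix (M : Matrix (Fin n) (Fin n) ℝ) :
    revMatrix n * M * revMatrix n = of fun i j => M i.rev j.rev := by
  ext i j
  rw [mul_revMatrix, revMatrix_mul, of_apply]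

/-- The factorization `P M P = A P D B` with unipotent factors `A`, `B`, where `D` is the diagonal
matrix with entries `d`. -/
def GaussEq (M A B : Matrix (Fin n) (Fin n) ℝ) (d : Fin n → ℝ) : Prop :=
  A ∈ unipotentUpper n ∧ B ∈ unipotentUpper n ∧
    revMatrix n * M * revMatrix n = A * revMatrix n * diagonal d * B

lemma revMatrix_mul_mul_revMatrix_eq_iff {M A B : Matrix (Fin n) (Fin n) ℝ} {d : Fin n → ℝ} :
    revMatrix n * M * revMatrix n = A * revMatrix n * diagonal d * B ↔
      ∀ i j, M i.rev j = ∑ l, A i l * (d l.rev * B l.rev j.rev) := by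
  have hmul (i j : Fin n) : (A * revMatrix n * diagonal d * B) i j
      = ∑ l, A i l * (d l.rev * B l.rev j) := by
    rw [mul_apply, ← Equiv.sum_comp Fin.revPerm]
    refine sum_congr rfl fun l _ => ?_
    rw [Fin.revPerm_apply, mul_diagonal, mul_revMatrix, Fin.rev_rev, mul_assoc]
  rw [revMatrix_mul_mul_revMatrix]
  constructor
  · intro h i j
    rw [← hmul, ← h, of_apply, Fin.rev_rev]
  · intro h
    ext i j
    rw [hmul, of_apply, h, Fin.rev_rev]

lemma GaussEq.antiT {M A B : Matrix (Fin n) (Fin n) ℝ} {d : Fin n → ℝ} (h : GaussEq M A B d) :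
    GaussEq (antiT M) (antiT B) (antiT A) d := by
  refine ⟨antiT_mem_unipotentUpper h.2.1, antiT_mem_unipotentUpper h.1,
    revMatrix_mul_mul_revMatrix_eq_iff.2 fun i j => ?_⟩
  simp only [TPDilog.antiT, of_apply, Fin.rev_rev]
  rw [revMatrix_mul_mul_revMatrix_eq_iff.1 h.2.2 j i]
  refine sum_congr rfl fun l _ => ?_
  ring

lemma GaussEq.exists_lastColumns_eq_mul {M A B : Matrix (Fin n) (Fin n) ℝ} {d : Fin n → ℝ}
    (h : GaussEq M A B d) {k : ℕ} (hk : k ≤ n) :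
    ∃ X : Matrix (Fin k) (Fin k) ℝ, ∀ f : Fin k → ℕ, (∀ i, f i < n) →
      (of fun i j : Fin k => entry M (n - 1 - f i) (n - k + j))
        = (of fun i j : Fin k => entry A (f i) (n - k + j)) * X := by
  let e (j : Fin k) : Fin n := ⟨n - k + j, by omega⟩
  have he : Function.Injective e := fun i j hij => by
    simpa [e, Fin.ext_iff] using hij
  refine ⟨of fun l j => d (e l).rev * B (e l).rev (e j).rev, fun f hf => ?_⟩
  ext i j
  have hrow : entry M (n - 1 - f i) (n - k + j) = M (Fin.rev ⟨f i, hf i⟩) (e j) := by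
    rw [← entry_val M, Fin.val_rev]
    congr 1
    dsimp only
    omega
  rw [of_apply, hrow, revMatrix_mul_mul_revMatrix_eq_iff.1 h.2.2, mul_apply]
  refine (Fintype.sum_of_injective e he _ _ (fun l hl => ?_) fun l => ?_).symm
  · -- The remaining columns `l` lie to the left of column `j`, where `B` vanishes.
    have hlj : l < e j := lt_of_not_ge fun hle => by
      have hle : n - k + j ≤ (l : ℕ) := hle
      refine hl ⟨⟨l - (n - k), by omega⟩, Fin.ext ?_⟩
      dsimp only [e]
      omega
    rw [h.2.1.2 _ _ (Fin.rev_lt_rev.2 hlj), mul_zero, mul_zero]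
  · rw [of_apply, of_apply]
    exact congr($(entry_val A ⟨f i, hf i⟩ (e l)) * _)

lemma flagMinor_reflectSet_image (M : Matrix (Fin n) (Fin n) ℝ) {k : ℕ} {f : Fin k → ℕ}
    (hf : StrictMono f) (hn : ∀ i, f i < n) :
    flagMinor M (reflectSet n (univ.image f)) = ((Equiv.Perm.sign (@Fin.revPerm k) : ℤ) : ℝ)
      * det (of fun i j => entry M (n - 1 - f i) (n - k + j)) := by
  rw [reflectSet_image, flagMinor_image _ (strictMono_reflect hf hn), ← det_permute]
  rfl

lemma reflectSet_subset {I : Finset ℕ} (hI : I ⊆ range n) : reflectSet n I ⊆ range n :=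
  fun _ hx => mem_range.2 ((mem_reflectSet hI).1 hx).1

lemma reflectSet_Ico (n k : ℕ) : reflectSet n (Ico (n - k) n) = Ico 0 (min k n) := by
  ext x
  rw [mem_reflectSet fun x hx => mem_range.2 (mem_Ico.1 hx).2]
  simp only [mem_Ico]
  omega

lemma GaussEq.flagMinor_mul {M A B : Matrix (Fin n) (Fin n) ℝ} {d : Fin n → ℝ}
    (h : GaussEq M A B d) {I : Finset ℕ} (hI : I ⊆ range n) :
    flagMinor A I * flagMinor M (Ico 0 #I) = flagMinor M (reflectSet n I) := by
  obtain ⟨k, hk⟩ : ∃ k, #I = k := ⟨_, rfl⟩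
  rw [hk]
  obtain ⟨s, hs, rfl⟩ := exists_strictMono_image hk
  rw [image_subset_range] at hI
  have hkn := card_le_of_strictMono hs hI
  obtain ⟨X, hX⟩ := h.exists_lastColumns_eq_mul hkn
  have hfactor {f : Fin k → ℕ} (hf : StrictMono f) (hn : ∀ i, f i < n) :
      flagMinor M (reflectSet n (univ.image f)) = ((Equiv.Perm.sign (@Fin.revPerm k) : ℤ) : ℝ)
        * (flagMinor A (univ.image f) * det X) := by
    rw [flagMinor_reflectSet_image M hf hn, flagMinor_image _ hf, hX f hn, det_mul]
  have hlast := hfactor (strictMono_add_val (n - k) k) fun i => by omega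
  rw [image_add_val, Nat.sub_add_cancel hkn, reflectSet_Ico, min_eq_left hkn, flagMinor_Ico h.1,
    one_mul] at hlast
  rw [hfactor hs hI, hlast]
  ring

lemma flagMinor_initial_pos {M : Matrix (Fin n) (Fin n) ℝ} (hM : M ∈ totallyPositive n) {k : ℕ}
    (hk : k ≤ n) : 0 < flagMinor M (Ico 0 k) :=
  flagMinor_pos hM fun _ hx => mem_range.2 ((mem_Ico.1 hx).2.trans_le hk)

lemma GaussEq.flagMinor_eq {M A B : Matrix (Fin n) (Fin n) ℝ} {d : Fin n → ℝ}
    (h : GaussEq M A B d) (hM : M ∈ totallyPositive n) {I : Finset ℕ} (hI : I ⊆ range n) :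
    flagMinor A I = flagMinor M (reflectSet n I) / flagMinor M (Ico 0 #I) := by
  have hk : #I ≤ n := by simpa using card_le_card hI
  rw [eq_div_iff (flagMinor_initial_pos hM hk).ne', h.flagMinor_mul hI]

lemma GaussEq.left_mem {M A B : Matrix (Fin n) (Fin n) ℝ} {d : Fin n → ℝ}
    (h : GaussEq M A B d) (hM : M ∈ totallyPositive n) : A ∈ totallyPositive n := by
  refine mem_totallyPositive_of_flagMinor_pos h.1 fun I hI => ?_
  have hk : #I ≤ n := by simpa using card_le_card hI
  rw [h.flagMinor_eq hM hI]
  exact div_pos (flagMinor_pos hM (reflectSet_subset hI)) (flagMinor_initial_pos hM hk)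

lemma GaussEq.right_mem {M A B : Matrix (Fin n) (Fin n) ℝ} {d : Fin n → ℝ}
    (h : GaussEq M A B d) (hM : M ∈ totallyPositive n) : B ∈ totallyPositive n := by
  rw [← antiT_antiT B]
  exact antiT_mem (h.antiT.left_mem (antiT_mem hM))

lemma flagMinor_singleton_union_Ico {M : Matrix (Fin n) (Fin n) ℝ} (hM : M ∈ unipotentUpper n)
    {i j : Fin n} (hij : i ≤ j) : flagMinor M ({(i : ℕ)} ∪ Ico (j + 1) n) = M i j := by
  have himage : ({(i : ℕ)} : Finset ℕ) = univ.image fun _ : Fin 1 => (i : ℕ) := rfl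
  rw [himage, flagMinor_image_union_Ico hM (Subsingleton.strictMono _)
    (fun _ => Nat.lt_succ_of_le hij) j.isLt]
  simp

lemma eq_of_flagMinor_eq {A A' : Matrix (Fin n) (Fin n) ℝ} (hA : A ∈ unipotentUpper n)
    (hA' : A' ∈ unipotentUpper n) (h : ∀ I ⊆ range n, flagMinor A I = flagMinor A' I) :
    A = A' := by
  ext i j
  rcases lt_or_ge j i with hij | hij
  · rw [hA.2 _ _ hij, hA'.2 _ _ hij]
  · rw [← flagMinor_singleton_union_Ico hA hij, ← flagMinor_singleton_union_Ico hA' hij]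
    refine h _ (union_subset ?_ fun x hx => mem_range.2 (mem_Ico.1 hx).2)
    exact singleton_subset_iff.2 (mem_range.2 i.isLt)

lemma GaussEq.left_unique {M A B A' B' : Matrix (Fin n) (Fin n) ℝ} {d d' : Fin n → ℝ}
    (h : GaussEq M A B d) (h' : GaussEq M A' B' d') (hM : M ∈ totallyPositive n) : A = A' :=
  eq_of_flagMinor_eq h.1 h'.1 fun I hI => by rw [h.flagMinor_eq hM hI, h'.flagMinor_eq hM hI]

lemma GaussEq.unique {M A B A' B' : Matrix (Fin n) (Fin n) ℝ} {d d' : Fin n → ℝ}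
    (h : GaussEq M A B d) (h' : GaussEq M A' B' d') (hM : M ∈ totallyPositive n) :
    A = A' ∧ B = B' ∧ d = d' := by
  have hA := h.left_unique h' hM
  have hB : B = B' := by
    rw [← antiT_antiT B, ← antiT_antiT B', h.antiT.left_unique h'.antiT (antiT_mem hM)]
  refine ⟨hA, hB, ?_⟩
  subst hA hB
  have hcancel := (isUnit_of_mem_unipotentUpper h.2.1).mul_right_cancel (h.2.2.symm.trans h'.2.2)
  rw [Matrix.mul_assoc, Matrix.mul_assoc] at hcancel
  have hdiag := (isUnit_of_mem_unipotentUpper h.1).mul_left_cancel hcancel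
  have hrev : IsUnit (revMatrix n) := IsUnit.of_mul_eq_one _ (revMatrix_mul_revMatrix n)
  exact diagonal_injective (hrev.mul_left_cancel hdiag)

lemma det_leading_mul_revMatrix_ne_zero {M : Matrix (Fin n) (Fin n) ℝ} (hM : M ∈ totallyPositive n)
    (i : Fin n) : ((M * revMatrix n).toSquareBlockProp (· < i)).det ≠ 0 := by
  let e : Fin i ≃ {j : Fin n // j < i} := ⟨fun a => ⟨a.castLE i.isLt.le, a.isLt⟩,
    fun a => ⟨a.1, a.2⟩, fun _ => rfl, fun _ => rfl⟩
  have hleading : ((M * revMatrix n).toSquareBlockProp (· < i)).submatrix e e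
      = (of fun a b : Fin i => entry M (0 + a) (n - i + b)).submatrix id Fin.revPerm := by
    ext a b
    have hb : ((b.castLE i.isLt.le).rev : ℕ) = n - i + b.rev := by
      simp only [Fin.val_rev, Fin.val_castLE]
      omega
    change (M * revMatrix n) (a.castLE i.isLt.le) (b.castLE i.isLt.le)
      = entry M (0 + a) (n - i + b.rev)
    rw [mul_revMatrix, ← entry_val M, hb, zero_add, Fin.val_castLE]
  rw [← det_submatrix_equiv_self e, hleading, det_permute',
    ← flagMinor_image M (strictMono_add_val 0 i), image_add_val, zero_add]
  refine mul_ne_zero ?_ (flagMinor_initial_pos hM i.isLt.le).ne'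
  exact_mod_cast (Equiv.Perm.sign (@Fin.revPerm i)).ne_zero

lemma exists_gaussEq {M : Matrix (Fin n) (Fin n) ℝ} (hM : M ∈ totallyPositive n) :
    ∃ A B d, GaussEq M A B d := by
  obtain ⟨L, U, d, ⟨hL1, hL⟩, hU, hdiag⟩ :=
    exists_mul_mul_eq_diagonal (M * revMatrix n) (det_leading_mul_revMatrix_ne_zero hM)
  have hU : U ∈ unipotentUpper n := ⟨hU.1, fun i j hij => hU.2 hij⟩
  have hC : revMatrix n * L * revMatrix n ∈ unipotentUpper n := by
    rw [revMatrix_mul_mul_revMatrix]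
    exact ⟨fun i => hL1 _, fun i j hij => hL (Fin.rev_lt_rev.2 hij)⟩
  refine ⟨_, U⁻¹, d, unipotentUpper_inv hC, unipotentUpper_inv hU, ?_⟩
  have hUdet := (isUnit_iff_isUnit_det U).1 (isUnit_of_mem_unipotentUpper hU)
  have hCdet := (isUnit_iff_isUnit_det _).1 (isUnit_of_mem_unipotentUpper hC)
  have hLM : L * (M * revMatrix n) = diagonal d * U⁻¹ := by
    rw [← hdiag, mul_nonsing_inv_cancel_right _ _ hUdet]
  have hC_mul : revMatrix n * L * revMatrix n * (revMatrix n * M * revMatrix n)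
      = revMatrix n * (L * (M * revMatrix n)) := by
    simp only [Matrix.mul_assoc]
    rw [← Matrix.mul_assoc (revMatrix n) (revMatrix n), revMatrix_mul_revMatrix, Matrix.one_mul]
  rw [Matrix.mul_assoc _ (diagonal d), ← hLM, Matrix.mul_assoc _ _ (L * _), ← hC_mul,
    nonsing_inv_mul_cancel_left _ _ hCdet]

theorem existsUnique_isGauss {M : Matrix (Fin n) (Fin n) ℝ} (hM : M ∈ totallyPositive n) :
    ∃! q : Matrix (Fin n) (Fin n) ℝ × Matrix (Fin n) (Fin n) ℝ × (Fin n → ℝ),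
      IsGauss M q.1 q.2.1 q.2.2 := by
  obtain ⟨A, B, d, h⟩ := exists_gaussEq hM
  refine ⟨(A, B, d), ⟨h.left_mem hM, h.right_mem hM, h.2.2⟩, ?_⟩
  rintro ⟨A', B', d'⟩ ⟨hA', hB', he⟩
  obtain ⟨rfl, rfl, rfl⟩ := h.unique ⟨hA'.1, hB'.1, he⟩ hM
  rfl

lemma isGauss_prime {M : Matrix (Fin n) (Fin n) ℝ} (hM : M ∈ totallyPositive n) :
    IsGauss M (prime M) (dprime M) (gaussTriple M).2.2 :=
  Classical.epsilon_spec (existsUnique_isGauss hM).exists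

lemma gaussEq_prime {M : Matrix (Fin n) (Fin n) ℝ} (hM : M ∈ totallyPositive n) :
    GaussEq M (prime M) (dprime M) (gaussTriple M).2.2 :=
  ⟨(isGauss_prime hM).1.1, (isGauss_prime hM).2.1.1, (isGauss_prime hM).2.2⟩

/-! ### The dilogarithm sums of the factors -/

lemma reflectSet_insert (n x : ℕ) (I : Finset ℕ) :
    reflectSet n (insert x I) = insert (n - 1 - x) (reflectSet n I) := image_insert _ _ _

lemma GaussEq.flagRatio_eq {M A B : Matrix (Fin n) (Fin n) ℝ} {d : Fin n → ℝ}
    (h : GaussEq M A B d) (hM : M ∈ totallyPositive n) {S : Finset ℕ} (hS : S ⊆ range n)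
    {a b c : ℕ} (ha : a ∉ S) (hb : b ∉ S) (hc : c ∉ S) (hab : a < b) (hbc : b < c) (hcn : c < n) :
    flagRatio A S a b c
      = (flagRatio M (reflectSet n S) (n - 1 - c) (n - 1 - b) (n - 1 - a))⁻¹ := by
  have hbn : b < n := hbc.trans hcn
  have han : a < n := hab.trans hbn
  have hsub {x : ℕ} (hx : x < n) {T : Finset ℕ} (hT : T ⊆ range n) : insert x T ⊆ range n :=
    insert_subset (mem_range.2 hx) hT
  have hone {x : ℕ} (hx : x ∉ S) (hxn : x < n) : flagMinor A (insert x S)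
      = flagMinor M (insert (n - 1 - x) (reflectSet n S)) / flagMinor M (Ico 0 (#S + 1)) := by
    rw [h.flagMinor_eq hM (hsub hxn hS), card_insert_of_notMem hx, reflectSet_insert]
  have htwo {x y : ℕ} (hx : x ∉ S) (hy : y ∉ S) (hxy : x < y) (hyn : y < n) :
      flagMinor A (insert x (insert y S))
      = flagMinor M (insert (n - 1 - y) (insert (n - 1 - x) (reflectSet n S)))
        / flagMinor M (Ico 0 (#S + 2)) := by
    rw [h.flagMinor_eq hM (hsub (hxy.trans hyn) (hsub hyn hS)), card_insert_insert hx hy hxy.ne,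
      reflectSet_insert, reflectSet_insert, insert_comm]
  have hcard : #S + 2 ≤ n := by
    simpa [card_insert_insert ha hb hab.ne] using card_le_card (hsub han (hsub hbn hS))
  have hpos := mul_pos (flagMinor_initial_pos hM (Nat.le_of_succ_le hcard))
    (flagMinor_initial_pos hM hcard)
  rw [flagRatio, flagRatio, hone ha han, hone hc hcn, htwo hb hc hbc hcn, htwo ha hb hab hbn,
    inv_div, div_mul_div_comm, div_mul_div_comm, mul_comm (flagMinor M (Ico 0 (#S + 2))),
    div_div_div_cancel_right₀ hpos.ne',
    mul_comm (flagMinor M (insert (n - 1 - a) (reflectSet n S))),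
    mul_comm (flagMinor M (insert (n - 1 - c) (reflectSet n S)))]

/-- The value of a dilogarithm sum all of whose ratios are `1`. -/
noncomputable def unitSum (n : ℕ) : ℝ :=
  ∑ k ∈ range n, ∑ j ∈ range k, ∑ _i ∈ range j, ell 1

lemma reflectSet_lowRows {i j k : ℕ} (hij : i < j) (hjk : j < k) (hk : k < n) :
    reflectSet n (lowRows n i j k) = tlowRows (n - 1 - k) (n - 1 - j) (n - 1 - i) := by
  ext x
  rw [mem_reflectSet (isRowSystem_lowRows n hij hjk hk).1]
  simp only [lowRows, tlowRows, mem_union, mem_Ico]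
  omega

lemma GaussEq.ellSum_left {M A B : Matrix (Fin n) (Fin n) ℝ} {d : Fin n → ℝ}
    (h : GaussEq M A B d) (hM : M ∈ totallyPositive n) :
    ellSum (lowRows n) A + ellSum (lowRows n) M = 2 * unitSum n := by
  rw [ellSum_lowRows_eq_tlowRows hM]
  simp only [ellSum, unitSum, mul_sum]
  rw [← sum_simplex_reflect fun i j k => ell (flagRatio M (tlowRows i j k) i j k)]
  simp only [← sum_add_distrib]
  refine sum_simplex_congr fun i j k hij hjk hk => ?_
  obtain ⟨hS, hi, hj, hk'⟩ := isRowSystem_lowRows n hij hjk hk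
  obtain ⟨hS', -⟩ := isRowSystem_tlowRows n (i := n - 1 - k) (j := n - 1 - j) (k := n - 1 - i)
    (by omega) (by omega) (by omega)
  rw [h.flagRatio_eq hM hS hi hj hk' hij hjk hk, reflectSet_lowRows hij hjk hk,
    ell_inv (flagRatio_pos hM hS' (by omega) (by omega) (by omega)), sub_add_cancel]

lemma GaussEq.ellSum_right {M A B : Matrix (Fin n) (Fin n) ℝ} {d : Fin n → ℝ}
    (h : GaussEq M A B d) (hM : M ∈ totallyPositive n) :
    ellSum (lowRows n) B + ellSum (lowRows n) M = 2 * unitSum n := by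
  rw [← ellSum_lowRows_antiT h.2.1, ← ellSum_lowRows_antiT hM.1, h.antiT.ellSum_left (antiT_mem hM)]

lemma IsImage.mem {M N : Matrix (Fin n) (Fin n) ℝ} {s : Equiv.Perm (Fin 3)}
    (h : IsImage s M N) (hM : M ∈ totallyPositive n) : N ∈ totallyPositive n := by
  have hprime {X : Matrix (Fin n) (Fin n) ℝ} (hX : X ∈ totallyPositive n) :
      prime X ∈ totallyPositive n := (isGauss_prime hX).1
  have hdprime {X : Matrix (Fin n) (Fin n) ℝ} (hX : X ∈ totallyPositive n) :
      dprime X ∈ totallyPositive n := (isGauss_prime hX).2.1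
  cases h with
  | id => exact hM
  | s1 => exact hprime hM
  | s2 => exact hdprime hM
  | s21 => exact hdprime (hprime hM)
  | s12 => exact hprime (hdprime hM)
  | s121 => exact hprime (hdprime (hprime hM))
  | s212 => exact hdprime (hprime (hdprime hM))

lemma IsImage.sign_mul_ellSum_sub {M N : Matrix (Fin n) (Fin n) ℝ} {s : Equiv.Perm (Fin 3)}
    (h : IsImage s M N) (hM : M ∈ totallyPositive n) :
    (Equiv.Perm.sign s : ℤ) * (ellSum (lowRows n) N - unitSum n)
      = ellSum (lowRows n) M - unitSum n := by
  have hsign₁ : Equiv.Perm.sign sigma1 = -1 := Equiv.Perm.sign_swap (by decide)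
  have hsign₂ : Equiv.Perm.sign sigma2 = -1 := Equiv.Perm.sign_swap (by decide)
  have hprime {X : Matrix (Fin n) (Fin n) ℝ} (hX : X ∈ totallyPositive n) :
      ellSum (lowRows n) (prime X) - unitSum n = -(ellSum (lowRows n) X - unitSum n) := by
    linarith [(gaussEq_prime hX).ellSum_left hX]
  have hdprime {X : Matrix (Fin n) (Fin n) ℝ} (hX : X ∈ totallyPositive n) :
      ellSum (lowRows n) (dprime X) - unitSum n = -(ellSum (lowRows n) X - unitSum n) := by
    linarith [(gaussEq_prime hX).ellSum_right hX]
  have hM₁ := (IsImage.s1 M).mem hM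
  have hM₂ := (IsImage.s2 M).mem hM
  cases h with
  | id => simp
  | s1 => simp [hsign₁, hprime hM]
  | s2 => simp [hsign₂, hdprime hM]
  | s21 => simp [hsign₁, hsign₂, hdprime hM₁, hprime hM]
  | s12 => simp [hsign₁, hsign₂, hprime hM₂, hdprime hM]
  | s121 => simp [hsign₁, hsign₂, hprime ((IsImage.s21 M).mem hM), hdprime hM₁, hprime hM]
  | s212 => simp [hsign₁, hsign₂, hdprime ((IsImage.s12 M).mem hM), hprime hM₂, hdprime hM]

lemma ell_zpow_sub {x : ℝ} (hx : 0 < x) (u : ℤˣ) :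
    ell (x ^ (u : ℤ)) - ell 1 = (u : ℤ) * (ell x - ell 1) := by
  rcases Int.units_eq_one_or u with rfl | rfl
  · simp
  · rw [Units.val_neg, Units.val_one, _root_.zpow_neg_one, ell_inv hx]
    push_cast
    ring

lemma dilogSum_sub_unitSum {R : ℕ → ℕ → ℕ → Finset ℕ} (hR : IsRowSystem n R)
    {M : Matrix (Fin n) (Fin n) ℝ} (hM : M ∈ totallyPositive n) {Z : ℕ → ℕ → ℕ → ℝ}
    (hZ : ∀ F : ℝ → ℝ, ∑ t ∈ tetra n, F (Z t.1 t.2.1 t.2.2)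
      = ∑ k ∈ range n, ∑ j ∈ range k, ∑ i ∈ range j, F (flagRatio M (R i j k) i j k))
    (s : Equiv.Perm (Fin 3)) :
    dilogSum n s Z - unitSum n = (Equiv.Perm.sign s : ℤ) * (ellSum R M - unitSum n) := by
  rw [dilogSum, hZ fun x => ell (x ^ ((Equiv.Perm.sign s : ℤˣ) : ℤ))]
  simp only [ellSum, unitSum, ← sum_sub_distrib, mul_sum]
  exact sum_simplex_congr fun i j k hij hjk hk => ell_zpow_sub
    (flagRatio_pos hM (hR hij hjk hk).1 ((hij.trans hjk).trans hk) (hjk.trans hk) hk) _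

lemma IsImage.dilogSum_eq {M N : Matrix (Fin n) (Fin n) ℝ} {s : Equiv.Perm (Fin 3)}
    (h : IsImage s M N) (hM : M ∈ totallyPositive n) {Z : ℕ → ℕ → ℕ → ℝ}
    (hZ : dilogSum n s Z - unitSum n
      = (Equiv.Perm.sign s : ℤ) * (ellSum (lowRows n) N - unitSum n)) :
    dilogSum n s Z = ellSum (lowRows n) M := by
  rwa [h.sign_mul_ellSum_sub hM, sub_left_inj] at hZ

lemma IsImage.dilogSum_Ylow {M N : Matrix (Fin n) (Fin n) ℝ} {s : Equiv.Perm (Fin 3)}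
    (h : IsImage s M N) (hM : M ∈ totallyPositive n) :
    dilogSum n s (Ylow N) = ellSum (lowRows n) M :=
  h.dilogSum_eq hM <| dilogSum_sub_unitSum (isRowSystem_lowRows n) (h.mem hM)
    (fun F => (sum_tetra (fun a b c => F (Ylow N a b c)) n).trans
      (sum_simplex_congr fun i j k hij hjk hk => by rw [Ylow_eq N hij hjk hk])) s

lemma IsImage.dilogSum_Ytlow {M N : Matrix (Fin n) (Fin n) ℝ} {s : Equiv.Perm (Fin 3)}
    (h : IsImage s M N) (hM : M ∈ totallyPositive n) :
    dilogSum n s (Ytlow N) = ellSum (lowRows n) M := by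
  refine h.dilogSum_eq hM ?_
  rw [ellSum_lowRows_eq_tlowRows (h.mem hM)]
  exact dilogSum_sub_unitSum (isRowSystem_tlowRows n) (h.mem hM)
    (fun F => (sum_tetra (fun a b c => F (Ytlow N a b c)) n).trans
      (sum_simplex_congr fun i j k hij hjk hk => by rw [Ytlow_eq N hij hjk hk])) s

lemma IsImage.dilogSum_Ytup {M N : Matrix (Fin n) (Fin n) ℝ} {s : Equiv.Perm (Fin 3)}
    (h : IsImage s M N) (hM : M ∈ totallyPositive n) :
    dilogSum n s (Ytup N) = ellSum (lowRows n) M := by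
  refine h.dilogSum_eq hM ?_
  rw [← ellSum_lowRows_antiT (h.mem hM).1]
  exact dilogSum_sub_unitSum (isRowSystem_lowRows n) (antiT_mem (h.mem hM))
    (fun F => (sum_tetra_reverse (fun a b c => F (Ytup N a b c)) n).trans
      (sum_simplex_congr fun i j k hij hjk hk => by rw [Ytup_eq N hij hjk hk])) s

lemma IsImage.dilogSum_Yup {M N : Matrix (Fin n) (Fin n) ℝ} {s : Equiv.Perm (Fin 3)}
    (h : IsImage s M N) (hM : M ∈ totallyPositive n) :
    dilogSum n s (Yup N) = ellSum (lowRows n) M := by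
  refine h.dilogSum_eq hM ?_
  rw [← ellSum_lowRows_antiT (h.mem hM).1, ellSum_lowRows_eq_tlowRows (antiT_mem (h.mem hM))]
  exact dilogSum_sub_unitSum (isRowSystem_tlowRows n) (antiT_mem (h.mem hM))
    (fun F => (sum_tetra_reverse (fun a b c => F (Yup N a b c)) n).trans
      (sum_simplex_congr fun i j k hij hjk hk => by rw [Yup_eq N hij hjk hk])) s

end TPDilog

theorem theorem3p8 (n : ℕ) (hn : 2 ≤ n) :
    -- the maps `M ↦ M'`, `M ↦ M''` are well defined on `N_n^+`
    (∀ M ∈ TPDilog.totallyPositive n,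
      ∃! q : Matrix (Fin n) (Fin n) ℝ × Matrix (Fin n) (Fin n) ℝ × (Fin n → ℝ),
        TPDilog.IsGauss M q.1 q.2.1 q.2.2) ∧
    -- the dilogarithm identities
    ∀ M ∈ TPDilog.totallyPositive n,
      ∀ (s₁ s₂ s₃ s₄ : Equiv.Perm (Fin 3)) (M₁ M₂ M₃ M₄ : Matrix (Fin n) (Fin n) ℝ),
        TPDilog.IsImage s₁ M M₁ → TPDilog.IsImage s₂ M M₂ →
        TPDilog.IsImage s₃ M M₃ → TPDilog.IsImage s₄ M M₄ →
          TPDilog.dilogSum n s₁ (TPDilog.Ylow M₁) = TPDilog.dilogSum n s₂ (TPDilog.Ytup M₂) ∧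
          TPDilog.dilogSum n s₂ (TPDilog.Ytup M₂) = TPDilog.dilogSum n s₃ (TPDilog.Ytlow M₃) ∧
          TPDilog.dilogSum n s₃ (TPDilog.Ytlow M₃) = TPDilog.dilogSum n s₄ (TPDilog.Yup M₄) := by
  refine ⟨fun M => TPDilog.existsUnique_isGauss,
    fun M hM s₁ s₂ s₃ s₄ M₁ M₂ M₃ M₄ h₁ h₂ h₃ h₄ => ?_⟩
  rw [h₁.dilogSum_Ylow hM, h₂.dilogSum_Ytup hM, h₃.dilogSum_Ytlow hM, h₄.dilogSum_Yup hM]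
  exact ⟨rfl, rfl, rfl⟩
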